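/- Let $a<0$ and $\alpha,\beta,\gamma>-1$, and put $s=\alpha+\beta+\gamma$. For $n,m\ge 0$ the Jacobi–Angelesco polynomial $P_{n,m}=P_{n,m}^{(\alpha,\beta,\gamma)}(x;a)$ is the monic polynomial of degree $n+m$ with $$\int_a^0 P_{n,m}(x)(x-a)^\alpha|x|^\beta(1-x)^\gamma x^k\,dx=0\ (0\le k<n),\qquad \int_0^1 P_{n,m}(x)(x-a)^\alpha x^\beta(1-x)^\gamma x^k\,dx=0\ (0\le k<m);$$ it exists and is unique. Put $$X_n=X_n^{(\alpha,\beta,\gamma)}=\frac{\int_a^0 x(x-a)^{\alpha+n}|x|^{\beta+n}(1-x)^{\gamma+n}\,dx}{\int_a^0 (x-a)^{\alpha+n}|x|^{\beta+n}(1-x)^{\gamma+n}\,dx}.$$ In the formulas below $n\ge0$ is arbitrary unless stated otherwise, and each formula is asserted whenever its denominators do not vanish. 1. $P_{1,0}^{(\alpha+n,\beta+n,\gamma+n)}(x;a)=x-X_n$ and $$P_{n+1,n}^{(\alpha,\beta,\gamma)}(x;a)=x\,P_{n,n}^{(\alpha,\beta+1,\gamma)}(x;a)-X_n\,\frac{s+2n+1}{s+3n+1}\,P_{n,n}^{(\alpha,\beta,\gamma)}(x;a).$$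 2. Let $P_{2n}=P_{n,n}$, $P_{2n+1}=P_{n+1,n}$, $P_{-1}=P_{-2}=0$. There are real $b_k,c_k,d_k$ with $xP_k=P_{k+1}+b_kP_k+c_kP_{k-1}+d_kP_{k-2}$ for all $k\ge0$, and for every such choice: $$b_{2n}=\frac{n[n+\gamma+a(n+\alpha)]}{(s+3n)(s+3n+1)}+X_n\frac{2n+s+1}{3n+s+1},$$ $$b_{2n+1}=\frac{5n^2+(4\alpha+4\beta+3\gamma+7)n+(s+1)(\alpha+\beta+2)+a[5n^2+(3\alpha+4\beta+4\gamma+7)n+(s+1)(\beta+\gamma+2)]}{(s+3n+1)(s+3n+3)}-X_n\frac{2n+s+1}{3n+s+1};$$ for $n\ge1$, with $E_n=(n+\gamma)(\alpha+\beta+2n)-2a(n+\alpha)(n+\gamma)+a^2(n+\alpha)(\beta+\gamma+2n)$, $$c_{2n}=\frac{n(s+2n)}{(s+3n-1)(s+3n)^2(s+3n+1)}\,E_n,$$ $$d_{2n}=\frac{n(s+2n)(s+2n-1)\bigl(-a(n+\beta)[n+\gamma+a(n+\alpha)]+X_{n-1}E_n\bigr)}{(s+3n-2)(s+3n-1)(s+3n)^2(s+3n+1)},$$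 $$d_{2n+1}=\frac{n(s+2n+1)(s+2n)\,F_n}{(s+3n+2)(s+3n+1)^2(s+3n)^2(s+3n-1)}-\frac{n(s+2n+1)(s+2n)X_n\,E_n}{(s+3n+1)^2(s+3n)^2(s+3n-1)},$$ $$F_n=(n+\gamma)(\alpha+\beta+2n)(\alpha+\beta+2n+1)-a(n+\alpha)(n+\gamma)(2\alpha+2\beta-\gamma+3n+1)-a^2(n+\alpha)(n+\gamma)(-\alpha+2\beta+2\gamma+3n+1)+a^3(n+\alpha)(\beta+\gamma+2n)(\beta+\gamma+2n+1);$$ and for $n\ge0$ $$c_{2n+1}=\frac{(s+2n+1)\,\bigl(T_n-aU_n+a^2V_n\bigr)}{(s+3n+3)(s+3n+2)(s+3n+1)^2(s+3n)}+\frac{(s+2n+1)(Y_n+aZ_n)}{(s+3n+3)(s+3n+1)^2(s+3n)}X_n-\frac{(s+2n+1)^2}{(s+3n+1)^2}X_n^2,$$ where $T_n=n(n+\gamma)(\alpha+\beta+2n+1)(s+3n+3)$, $V_n=n(n+\alpha)(\beta+\gamma+2n+1)(s+3n+3)$, $$\begin{aligned}U_n={}&24n^4+(29\alpha+41\beta+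29\gamma+48)n^3\\&+(10\alpha^2+39\alpha\beta+26\alpha\gamma+29\beta^2+39\beta\gamma+10\gamma^2+44\alpha+62\beta+44\gamma+30)n^2\\&+(\alpha^3+11\alpha^2\beta+5\alpha^2\gamma+19\alpha\beta^2+24\alpha\beta\gamma+5\alpha\gamma^2+9\beta^3+19\beta^2\gamma+11\beta\gamma^2+\gamma^3\\&\quad+11\alpha^2+39\alpha\beta+28\alpha\gamma+28\beta^2+39\beta\gamma+11\gamma^2+19\alpha+25\beta+19\gamma+6)n\\&+s(s+1)(s+2)(\beta+1),\end{aligned}$$ $$Y_n=12n^3+(16\alpha+16\beta+10\gamma+18)n^2+[s(7\alpha+7\beta+2\gamma)+16\alpha+16\beta+10\gamma+6]n+s^2(\alpha+\beta)+s(3\alpha+3\beta+2\gamma+2),$$ $$Z_n=12n^3+(10\alpha+16\beta+16\gamma+18)n^2+[s(2\alpha+7\beta+7\gamma)+10\alpha+16\beta+16\gamma+6]n+s^2(\beta+\gamma)+s(2\alpha+3\beta+3\gamma+2).$$ For the small indices where denominators can vanish, the formulas remain true, without any restriction, after cancelling common factors: $b_0=X_0$, $\;b_1=\frac{\alpha+\beta+2+a(\beta+\gamma+2)}{s+3}-X_0$,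 $\;c_1=\frac{-a(\beta+1)+[\alpha+\beta+2+a(\beta+\gamma+2)]X_0}{s+3}-X_0^2$, $\;c_2=\frac{E_1}{(s+3)^2(s+4)}$, $\;d_2=\frac{-a(1+\beta)[1+\gamma+a(1+\alpha)]+X_0E_1}{(s+3)^2(s+4)}$, $\;d_3=\frac{F_1}{(s+5)(s+4)^2(s+3)}-\frac{X_1E_1}{(s+4)^2(s+3)}$. 3. Let $g(x)=(x-a)x(x-1)$. The derivative $g'$ has exactly one zero $x_1$ in $[a,0]$ and exactly one zero $x_2$ in $[0,1]$; $x_1+x_2=\frac{2(a+1)}3$, and $\lim_{n\to\infty}X_n=x_1$. 4. As $n\to\infty$, $$b_{2n}\to\frac{a+1}9+\frac{2x_1}3,\qquad b_{2n+1}\to\frac{5(a+1)}9-\frac{2x_1}3=\frac{a+1}9+\frac{2x_2}3,\qquad c_n\to\frac4{81}(a^2-a+1),$$ $$c_{2n+1}\to-\frac49x_1^2+\frac8{27}(a+1)x_1+\frac4{81}(a^2-4a+1)=\frac4{81}(a^2-a+1),$$ $$d_{2n}\to\frac4{243}[2(a^2-a+1)x_1-a(a+1)]=-\frac4{27}g(x_1),$$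 $$d_{2n+1}\to\frac4{729}(4a^3-3a^2-3a+4)-\frac{8x_1}{243}(a^2-a+1)=-\frac4{27}g(x_2).$$ -/

import Mathlib

open Polynomial Filter Topology

noncomputable section

namespace JacobiAngelesco

/-- The Jacobi--Angelesco weight `(x - a)^α |x|^β (1 - x)^γ`, used on `[a, 0]` and on `[0, 1]`. -/
def weight (α β γ a : ℝ) (x : ℝ) : ℝ :=
  (x - a) ^ α * |x| ^ β * (1 - x) ^ γ

/-- `Q` is a type II multiple orthogonal polynomial with multi-index `(n, m)` for the
Jacobi--Angelesco weight: it is monic of degree `n + m`, orthogonal to `1, x, …, x^(n-1)` on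
`[a, 0]` and to `1, x, …, x^(m-1)` on `[0, 1]`. -/
def IsTypeII (α β γ a : ℝ) (n m : ℕ) (Q : ℝ[X]) : Prop :=
  Q.Monic ∧ Q.natDegree = n + m ∧
    (∀ k < n, ∫ x in a..0, Q.eval x * weight α β γ a x * x ^ k = 0) ∧
    (∀ k < m, ∫ x in (0 : ℝ)..1, Q.eval x * weight α β γ a x * x ^ k = 0)

/-- The Jacobi--Angelesco polynomial `P_{n,m}^{(α,β,γ)}(x;a)`. -/
def poly (α β γ a : ℝ) (n m : ℕ) : ℝ[X] :=
  Classical.epsilon (IsTypeII α β γ a n m)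

/-- The polynomials along the step line: `seq (2n) = P_{n,n}`, `seq (2n+1) = P_{n+1,n}`. -/
def seq (α β γ a : ℝ) (k : ℕ) : ℝ[X] :=
  poly α β γ a ((k + 1) / 2) (k / 2)

/-- The ratio of integrals `X_n^{(α,β,γ)}`. -/
def ratioX (α β γ a : ℝ) (n : ℕ) : ℝ :=
  (∫ x in a..0, x * weight (α + n) (β + n) (γ + n) a x) /
    (∫ x in a..0, weight (α + n) (β + n) (γ + n) a x)

/-- The four-term recurrence `x P_k = P_{k+1} + b_k P_k + c_k P_{k-1} + d_k P_{k-2}` for all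
`k ≥ 0`, with `P_{-1} = P_{-2} = 0`. -/
def IsRecurrence (α β γ a : ℝ) (b c d : ℕ → ℝ) : Prop :=
  ∀ k : ℕ, X * seq α β γ a k = seq α β γ a (k + 1) + C (b k) * seq α β γ a k
    + (if 1 ≤ k then C (c k) * seq α β γ a (k - 1) else 0)
    + (if 2 ≤ k then C (d k) * seq α β γ a (k - 2) else 0)

/-- The cubic `g(x) = (x - a) x (x - 1)`. -/
def cubic (a : ℝ) (x : ℝ) : ℝ := (x - a) * x * (x - 1)

end JacobiAngelesco

end

noncomputable section

namespace JacobiAngelesco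

/-! ### Integrability of the weight and signs on the two intervals of orthogonality. -/

section

open MeasureTheory Set

/-! Let `g = (x - a) x (x - 1)` and let `w` be the weight. Existence and uniqueness rest on counting
sign changes: a nonzero polynomial with `n` vanishing moments on `[a, 0]` and `m` on `[0, 1]` has at
least `n + m` zeros (`eq_zero_of_orthogonal`). So the square linear system defining `P_{n,m}` is
nonsingular, and any polynomial of too small degree with these orthogonality relations is zero; the
latter also yields the four-term recurrence.

The engine is the raising operator `p ↦ w⁻¹ D(w g p)`. Integration by parts has no boundary terms,
because `g` vanishes at all endpoints, so the operator gains one order of orthogonality on each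
interval and sends `P_{n,m}` for the parameters increased by 1 to a multiple of `P_{n+1,m+1}`
(`C_mul_poly_succ_succ`). Iteration from `P_{1,0} = x - X_n` expresses `P_{n+1,n}` through diagonal
polynomials (`C_mul_poly_succ_self`). Iteration from `1` is a Rodrigues formula `P_{n,n} ∝ w⁻¹ Dⁿ(w
gⁿ)`: expanding `w gⁿ` at infinity as `x^N (1 - a/x)^A (1 - 1/x)^C`, differentiating termwise and
dividing by `w` gives the three coefficients below the leading one (`coeff_poly_self`).

Comparing powers of `x` in the recurrence expresses `b`, `c`, `d` through these coefficients, and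
rational identities in `A`, `C`, `N`, `n`, `a` bring them to closed form. When a general denominator
may vanish, the explicit `P_{1,1}` and `P_{2,1}` are used instead.

Finally, raising the parameters by `n` multiplies the weight on `(a, 0)` by `gⁿ`, so Laplace's
method gives `X_n → x₁`, the maximum point of `g` on `[a, 0]` (`tendsto_ratioX`). The closed
formulas are continuous functions of `1/n` and of a term of the sequence `X`, evaluated in the limit
at `(0, x₁)`. -/

theorem intervalIntegrable_sub_rpow_mul_sub_rpow {u v p q : ℝ} (huv : u < v) (hp : -1 < p)
    (hq : -1 < q) : IntervalIntegrable (fun x => (x - u) ^ p * (v - x) ^ q) volume u v := by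
  -- Cutting at the midpoint leaves a single singular factor on each half; the other one is
  -- continuous there.
  have h1 : IntervalIntegrable (fun x => (x - u) ^ p * (v - x) ^ q) volume u ((u + v) / 2) := by
    refine IntervalIntegrable.mul_continuousOn ?_ ?_
    · have := (intervalIntegral.intervalIntegrable_rpow' (a := 0) (b := (u +
        v) / 2 - u) hp).comp_sub_right u
      simpa using this
    · rw [uIcc_of_le (by linarith)]
      refine ContinuousOn.rpow_const (by fun_prop) fun x hx => Or.inl ?_
      have := hx.2
      intro h; linarith
  have h2 : IntervalIntegrable (fun x => (x - u) ^ p * (v - x) ^ q) volume ((u + v) / 2) v := by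
    refine IntervalIntegrable.continuousOn_mul ?_ ?_
    · have := (intervalIntegral.intervalIntegrable_rpow' (a := v - (u +
        v) / 2) (b := 0) hq).comp_sub_left v
      simpa using this
    · rw [uIcc_of_le (by linarith)]
      refine ContinuousOn.rpow_const (by fun_prop) fun x hx => Or.inl ?_
      have := hx.1
      intro h; linarith
  exact h1.trans h2

theorem intervalIntegrable_weight_left {α β γ a : ℝ} (hα : -1 < α) (hβ : -1 < β) (ha : a < 0) :
    IntervalIntegrable (weight α β γ a) volume a 0 := by
  have h := (intervalIntegrable_sub_rpow_mul_sub_rpow ha hα hβ).mul_continuousOn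
    (g := fun x => (1 - x) ^ γ) (by
      rw [uIcc_of_le ha.le]
      refine ContinuousOn.rpow_const (by fun_prop) fun x hx => Or.inl ?_
      have := hx.2
      intro h; linarith)
  refine h.congr fun x hx => ?_
  rw [uIoc_of_le ha.le] at hx
  simp only [weight, abs_of_nonpos hx.2, zero_sub]

theorem intervalIntegrable_weight_right {α β γ a : ℝ} (hβ : -1 < β) (hγ : -1 < γ) (ha : a < 0) :
    IntervalIntegrable (weight α β γ a) volume 0 1 := by
  have h := (intervalIntegrable_sub_rpow_mul_sub_rpow one_pos hβ hγ).continuousOn_mul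
    (g := fun x => (x - a) ^ α) (by
      rw [uIcc_of_le zero_le_one]
      refine ContinuousOn.rpow_const (by fun_prop) fun x hx => Or.inl ?_
      have := hx.1
      intro h; linarith)
  refine h.congr fun x hx => ?_
  rw [uIoc_of_le zero_le_one] at hx
  simp only [weight, abs_of_pos hx.1, sub_zero]
  ring

/-- One of the two intervals of orthogonality. -/
def IsSide (a u v : ℝ) : Prop := (u = a ∧ v = 0) ∨ (u = 0 ∧ v = 1)

theorem IsSide.lt {a u v : ℝ} (h : IsSide a u v) (ha : a < 0) : u < v := by
  rcases h with ⟨rfl, rfl⟩ | ⟨rfl, rfl⟩ <;> linarith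

theorem IsSide.bounds {a u v x : ℝ} (h : IsSide a u v) (ha : a < 0) (hx : x ∈ Icc u v) :
    0 ≤ x - a ∧ 0 ≤ 1 - x := by
  rcases h with ⟨rfl, rfl⟩ | ⟨rfl, rfl⟩ <;> constructor <;> linarith [hx.1, hx.2]

theorem IsSide.bounds_pos {a u v x : ℝ} (h : IsSide a u v) (ha : a < 0) (hx : x ∈ Ioo u v) :
    0 < x - a ∧ 0 < |x| ∧ 0 < 1 - x := by
  rcases h with ⟨rfl, rfl⟩ | ⟨rfl, rfl⟩
  · exact ⟨by linarith [hx.1], abs_pos.2 hx.2.ne, by linarith [hx.2]⟩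
  · exact ⟨by linarith [hx.1], abs_pos.2 hx.1.ne', by linarith [hx.2]⟩

theorem intervalIntegrable_weight {α β γ a u v : ℝ} (hα : -1 < α) (hβ : -1 < β) (hγ : -1 < γ)
    (ha : a < 0) (h : IsSide a u v) : IntervalIntegrable (weight α β γ a) volume u v := by
  rcases h with ⟨rfl, rfl⟩ | ⟨rfl, rfl⟩
  · exact intervalIntegrable_weight_left hα hβ ha
  · exact intervalIntegrable_weight_right hβ hγ ha

theorem intervalIntegrable_eval_mul_weight {α β γ a u v : ℝ} (hα : -1 < α) (hβ : -1 < β)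
    (hγ : -1 < γ) (ha : a < 0) (h : IsSide a u v) (Q : ℝ[X]) :
    IntervalIntegrable (fun x => Q.eval x * weight α β γ a x) volume u v :=
  (intervalIntegrable_weight hα hβ hγ ha h).continuousOn_mul Q.continuous.continuousOn

theorem weight_pos {α β γ a u v x : ℝ} (ha : a < 0) (h : IsSide a u v) (hx : x ∈ Ioo u v) :
    0 < weight α β γ a x := by
  obtain ⟨h1, h2, h3⟩ := h.bounds_pos ha hx
  unfold weight
  positivity

/-- The sign of `(x - a) x (x - 1)` on a side. -/
theorem IsSide.exists_sign {a u v : ℝ} (h : IsSide a u v) : ∃ ε : ℝ, ε ≠ 0 ∧ ε * ε = 1 ∧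
    ∀ x ∈ Icc u v, |x| = -ε * x := by
  rcases h with ⟨rfl, rfl⟩ | ⟨rfl, rfl⟩
  · exact ⟨1, by norm_num, by norm_num, fun x hx => by rw [abs_of_nonpos hx.2]; ring⟩
  · exact ⟨-1, by norm_num, by norm_num, fun x hx => by rw [abs_of_nonneg hx.1]; ring⟩

theorem weight_add_one {α β γ a u v x : ℝ} (hα : -1 < α) (hβ : -1 < β) (hγ : -1 < γ)
    (ha : a < 0) (h : IsSide a u v) (hx : x ∈ Icc u v) :
    weight (α + 1) (β + 1) (γ + 1) a x = (x - a) * |x| * (1 - x) * weight α β γ a x := by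
  obtain ⟨h1, h3⟩ := h.bounds ha hx
  unfold weight
  rw [Real.rpow_add_one' h1 (by linarith), Real.rpow_add_one' (abs_nonneg x) (by linarith),
    Real.rpow_add_one' h3 (by linarith)]
  ring

/-! ### The raising operator and integration by parts. -/

/-- The raising operator `w⁻¹ D (w g ·)` for the Jacobi--Angelesco weight, `g = (x - a) x (x - 1)`. -/
def raise (α β γ a : ℝ) (p : ℝ[X]) : ℝ[X] :=
  (X - C a) * X * (X - 1) * derivative p +
    (C (α + 1) * (X * (X - 1)) + C (β + 1) * ((X - C a) * (X - 1)) +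
      C (γ + 1) * ((X - C a) * X)) * p

/-- The raised weight is `ε g w`, with `ε = 1` on the left interval and `ε = -1` on the right one.
Keeping `ε` outside lets the same polynomial operator serve both intervals. -/
theorem hasDerivAt_weight_mul {α β γ a u v x ε : ℝ} (ha : a < 0)
    (h : IsSide a u v) (hs : ∀ x ∈ Icc u v, |x| = -ε * x) (hx : x ∈ Ioo u v)
    (q : ℝ[X]) :
    HasDerivAt (fun y => weight (α + 1) (β + 1) (γ + 1) a y * q.eval y)
      (ε * ((raise α β γ a q).eval x * weight α β γ a x)) x := by
  obtain ⟨h1, h2, h3⟩ := h.bounds_pos ha hx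
  have e : |x| = -ε * x := hs x (Ioo_subset_Icc_self hx)
  have d1 : HasDerivAt (fun y : ℝ => (y - a) ^ (α + 1)) ((α + 1) * (x - a) ^ α) x := by
    have := ((hasDerivAt_id x).sub_const a).rpow_const (p := α + 1) (Or.inl h1.ne')
    simpa using this
  have d3 : HasDerivAt (fun y : ℝ => (1 - y) ^ (γ + 1)) (-((γ + 1) * (1 - x) ^ γ)) x := by
    have := ((hasDerivAt_id x).const_sub 1).rpow_const (p := γ + 1) (Or.inl h3.ne')
    refine this.congr_deriv ?_
    simp only [id, add_sub_cancel_right]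
    ring
  have d2 : HasDerivAt (fun y : ℝ => |y| ^ (β + 1)) (-ε * ((β + 1) * |x| ^ β)) x := by
    have h0 : HasDerivAt (fun y : ℝ => -ε * y) (-ε) x := by
      simpa using (hasDerivAt_id x).const_mul (-ε)
    have := h0.rpow_const (p := β + 1) (Or.inl (by rw [← e]; exact h2.ne'))
    -- Near an interior point the absolute value is the linear function `-ε y`, hence
    -- differentiable.
    have h4 := this.congr_of_eventuallyEq (f₁ := fun y : ℝ => |y| ^ (β + 1)) (by
      filter_upwards [Ioo_mem_nhds hx.1 hx.2] with y hy
      rw [hs y (Ioo_subset_Icc_self hy)])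
    refine h4.congr_deriv ?_
    rw [e, add_sub_cancel_right]
    ring
  have key := ((d1.mul d2).mul d3).mul (q.hasDerivAt x)
  unfold weight
  refine key.congr_deriv ?_
  simp only [Pi.mul_apply]
  rw [Real.rpow_add_one h1.ne', Real.rpow_add_one h2.ne', Real.rpow_add_one h3.ne']
  simp only [raise, eval_add, eval_mul, eval_sub, eval_X, eval_C, eval_one]
  generalize (x - a) ^ α = wa
  generalize (1 - x) ^ γ = wc
  generalize |x| ^ β = wb
  rw [e]
  ring

theorem continuousOn_weight_add_one {α β γ a : ℝ} (hα : -1 < α) (hβ : -1 < β) (hγ : -1 < γ) :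
    Continuous (weight (α + 1) (β + 1) (γ + 1) a) := by
  unfold weight
  refine ((Continuous.rpow_const (by fun_prop) fun x => Or.inr (by linarith)).mul
    (Continuous.rpow_const (by fun_prop) fun x => Or.inr (by linarith))).mul
    (Continuous.rpow_const (by fun_prop) fun x => Or.inr (by linarith))

/-- The integrand is, up to sign, a total derivative. Its primitive contains the raised weight,
which is continuous up to the endpoints and zero there because the exponents exceed 0, even if `w`
itself blows up. -/
theorem integral_raise_mul_weight {α β γ a u v : ℝ} (hα : -1 < α) (hβ : -1 < β) (hγ : -1 < γ)
    (ha : a < 0) (h : IsSide a u v) (q : ℝ[X]) :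
    ∫ x in u..v, (raise α β γ a q).eval x * weight α β γ a x = 0 := by
  obtain ⟨ε, h0, hε, hs⟩ := h.exists_sign
  have huv := h.lt ha
  have key := intervalIntegral.integral_eq_sub_of_hasDerivAt_of_le huv.le
    ((continuousOn_weight_add_one hα hβ hγ).mul q.continuous).continuousOn
    (fun x hx => hasDerivAt_weight_mul (α := α) (β := β) (γ := γ) ha h hs hx q)
    ((intervalIntegrable_eval_mul_weight hα hβ hγ ha h _).const_mul ε)
  rw [intervalIntegral.integral_const_mul, Pi.mul_apply, Pi.mul_apply,
    weight_add_one hα hβ hγ ha h (right_mem_Icc.2 huv.le),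
    weight_add_one hα hβ hγ ha h (left_mem_Icc.2 huv.le)] at key
  have : (u - a) * |u| * (1 - u) = 0 ∧ (v - a) * |v| * (1 - v) = 0 := by
    rcases h with ⟨rfl, rfl⟩ | ⟨rfl, rfl⟩ <;> simp
  rw [this.1, this.2] at key
  simpa [h0] using key

theorem eval_mul_mul_pow (Q : ℝ[X]) (w x : ℝ) (k : ℕ) :
    Q.eval x * w * x ^ k = (Q * X ^ k).eval x * w := by
  simp only [eval_mul, eval_pow, eval_X]
  ring

/-- Orthogonality of `raise p` to the powers of `x`. -/
theorem integral_raise_mul_pow {α β γ a u v : ℝ} (hα : -1 < α) (hβ : -1 < β) (hγ : -1 < γ)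
    (ha : a < 0) (h : IsSide a u v) (p : ℝ[X]) {n : ℕ}
    (hp : ∀ k < n, ∫ x in u..v, p.eval x * weight (α + 1) (β + 1) (γ + 1) a x * x ^ k = 0) :
    ∀ k < n + 1, ∫ x in u..v, (raise α β γ a p).eval x * weight α β γ a x * x ^ k = 0 := by
  obtain ⟨ε, h0, hε, hs⟩ := h.exists_sign
  have huv := h.lt ha
  intro k hk
  have key := integral_raise_mul_weight hα hβ hγ ha h (p * X ^ k)
  -- Leibniz rule for `p x^k`: the term where `x^k` is differentiated carries `g w`, which is `ε`
  -- times the raised weight since `ε² = 1`.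
  have e : ∀ x ∈ uIcc u v, (raise α β γ a (p * X ^ k)).eval x * weight α β γ a x =
      (raise α β γ a p).eval x * weight α β γ a x * x ^ k +
      (ε * k) * (p.eval x * weight (α + 1) (β + 1) (γ + 1) a x * x ^ (k - 1)) := by
    intro x hx
    rw [uIcc_of_le huv.le] at hx
    rw [weight_add_one hα hβ hγ ha h hx, hs x hx]
    simp only [raise, eval_add, eval_mul, eval_sub, eval_X, eval_C, eval_one, derivative_mul,
      derivative_X_pow, eval_pow]
    linear_combination ((x - a) * x * (1 - x) * k * p.eval x * x ^ (k - 1) * weight α β γ a x) * hε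
  rw [intervalIntegral.integral_congr e, intervalIntegral.integral_add,
    intervalIntegral.integral_const_mul] at key
  -- For `k = 0` the truncated exponent `k - 1` is harmless, because the factor `k` kills the term.
  · rcases Nat.eq_zero_or_pos k with rfl | hk0
    · simpa using key
    · rwa [hp (k - 1) (by omega), mul_zero, add_zero] at key
  · simp_rw [eval_mul_mul_pow]
    exact intervalIntegrable_eval_mul_weight hα hβ hγ ha h _
  · refine IntervalIntegrable.const_mul ?_ _
    simp_rw [eval_mul_mul_pow]
    exact intervalIntegrable_eval_mul_weight (by linarith) (by linarith) (by linarith) ha h _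

/-! ### Sign changes; existence and uniqueness of the polynomials. -/

/-- Multiplying a nonzero polynomial by linear factors at some of its roots in an interval
makes its sign constant there. -/
theorem exists_finset_roots_const_sign {P : ℝ[X]} (hP : P ≠ 0) (u v : ℝ) :
    ∃ S : Finset ℝ, (∀ r ∈ S, r ∈ Ioo u v ∧ P.IsRoot r) ∧
      ((∀ x ∈ Ioo u v, 0 ≤ (P * ∏ r ∈ S, (X - C r)).eval x) ∨
        (∀ x ∈ Ioo u v, (P * ∏ r ∈ S, (X - C r)).eval x ≤ 0)) := by
  induction hn : P.natDegree generalizing P with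
  | zero =>
    rw [eq_C_of_natDegree_eq_zero hn]
    refine ⟨∅, by simp, ?_⟩
    rcases le_total 0 (P.coeff 0) with h | h
    · left; simp [h]
    · right; simp [h]
  | succ n ih =>
    by_cases hr : ∃ r ∈ Ioo u v, P.IsRoot r
    · obtain ⟨r, hr, hroot⟩ := hr
      obtain ⟨P', rfl⟩ := dvd_iff_isRoot.2 hroot
      have hP' : P' ≠ 0 := right_ne_zero_of_mul hP
      have hd : P'.natDegree = n := by
        rw [natDegree_mul (X_sub_C_ne_zero r) hP', natDegree_X_sub_C] at hn
        omega
      obtain ⟨S, hS, hsign⟩ := ih hP' hd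
      have hroots : ∀ t ∈ S, ((X - C r) * P').IsRoot t := fun t ht => by
        simp [IsRoot.def, (hS t ht).2.eq_zero]
      -- `S` records the roots of odd multiplicity, so one more factor `X - r` toggles the
      -- membership of `r`.
      by_cases hrS : r ∈ S
      · refine ⟨S.erase r, fun t ht => ⟨(hS t (Finset.mem_of_mem_erase ht)).1,
          hroots t (Finset.mem_of_mem_erase ht)⟩, ?_⟩
        have e : (X - C r) * P' * ∏ t ∈ S.erase r, (X - C t) = P' * ∏ t ∈ S, (X - C t) := by
          rw [← Finset.mul_prod_erase S _ hrS]
          ring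
        rw [e]
        exact hsign
      · refine ⟨insert r S, fun t ht => ?_, ?_⟩
        · rcases Finset.mem_insert.1 ht with rfl | ht
          · exact ⟨hr, hroot⟩
          · exact ⟨(hS t ht).1, hroots t ht⟩
        · have e : (X - C r) * P' * ∏ t ∈ insert r S, (X - C t) =
              (X - C r) ^ 2 * (P' * ∏ t ∈ S, (X - C t)) := by
            rw [Finset.prod_insert hrS]
            ring
          rw [e]
          refine hsign.imp (fun h x hx => ?_) (fun h x hx => ?_)
          · rw [eval_mul, eval_pow]
            exact mul_nonneg (sq_nonneg _) (h x hx)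
          · rw [eval_mul, eval_pow]
            exact mul_nonpos_of_nonneg_of_nonpos (sq_nonneg _) (h x hx)
    · push Not at hr
      refine ⟨∅, by simp, ?_⟩
      simp only [Finset.prod_empty, mul_one]
      by_contra! hcon
      -- Values of both signs would force a root, by the intermediate value theorem.
      obtain ⟨⟨x, hx, hx'⟩, ⟨y, hy, hy'⟩⟩ := hcon
      obtain ⟨z, hz, hz'⟩ := isPreconnected_Ioo.intermediate_value hx hy
        P.continuous.continuousOn ⟨hx'.le, hy'.le⟩
      exact hr z hz hz'

theorem integral_mul_eval_mul_weight_eq_zero {α β γ a u v : ℝ} (hα : -1 < α) (hβ : -1 < β)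
    (hγ : -1 < γ) (ha : a < 0) (h : IsSide a u v) {P : ℝ[X]} {n : ℕ}
    (hP : ∀ k < n, ∫ x in u..v, P.eval x * weight α β γ a x * x ^ k = 0) {Q : ℝ[X]}
    (hQ : Q.natDegree < n) :
    ∫ x in u..v, (P * Q).eval x * weight α β γ a x = 0 := by
  have e : ∀ x, (P * Q).eval x * weight α β γ a x =
      ∑ k ∈ Finset.range n, Q.coeff k * (P.eval x * weight α β γ a x * x ^ k) := by
    intro x
    rw [eval_mul, eval_eq_sum_range' hQ, Finset.mul_sum, Finset.sum_mul]
    exact Finset.sum_congr rfl fun k _ => by ring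
  simp_rw [e]
  rw [intervalIntegral.integral_finsetSum]
  · refine Finset.sum_eq_zero fun k hk => ?_
    rw [intervalIntegral.integral_const_mul, hP k (Finset.mem_range.1 hk), mul_zero]
  · intro k _
    refine IntervalIntegrable.const_mul ?_ _
    simp_rw [eval_mul_mul_pow]
    exact intervalIntegrable_eval_mul_weight hα hβ hγ ha h _

theorem integral_eval_mul_weight_pos {α β γ a u v : ℝ} (hα : -1 < α) (hβ : -1 < β)
    (hγ : -1 < γ) (ha : a < 0) (h : IsSide a u v) {P : ℝ[X]} (hP : P ≠ 0)
    (hpos : ∀ x ∈ Ioo u v, 0 ≤ P.eval x) :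
    0 < ∫ x in u..v, P.eval x * weight α β γ a x := by
  have huv := h.lt ha
  have hi := intervalIntegrable_eval_mul_weight hα hβ hγ ha h P
  rw [intervalIntegral.integral_of_le huv.le, integral_Ioc_eq_integral_Ioo]
  rw [intervalIntegrable_iff_integrableOn_Ioo_of_le huv.le] at hi
  rw [setIntegral_pos_iff_support_of_nonneg_ae _ hi]
  · have hsub : Ioo u v \ (P.roots.toFinset : Set ℝ) ⊆
        Function.support (fun x => P.eval x * weight α β γ a x) ∩ Ioo u v := by
      rintro x ⟨hx, hx'⟩
      refine ⟨mul_ne_zero (fun h0 => hx' ?_) (weight_pos ha h hx).ne', hx⟩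
      simp [hP, h0]
    refine lt_of_lt_of_le ?_ (measure_mono hsub)
    -- The zeros form a finite, hence null, set, so the support keeps the full length of the
    -- interval.
    rw [measure_sdiff_null (Finset.measure_zero _ _), Real.volume_Ioo]
    simpa using huv
  · filter_upwards [ae_restrict_mem measurableSet_Ioo] with x hx
    exact mul_nonneg (hpos x hx) (weight_pos ha h hx).le

/-- A nonzero polynomial orthogonal to `1, …, x^(n-1)` has at least `n` roots inside the interval. -/
theorem exists_finset_roots_of_orthogonal {α β γ a u v : ℝ} (hα : -1 < α) (hβ : -1 < β)
    (hγ : -1 < γ) (ha : a < 0) (h : IsSide a u v) {P : ℝ[X]} (hP0 : P ≠ 0) {n : ℕ}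
    (hP : ∀ k < n, ∫ x in u..v, P.eval x * weight α β γ a x * x ^ k = 0) :
    ∃ S : Finset ℝ, (∀ r ∈ S, r ∈ Ioo u v ∧ P.IsRoot r) ∧ n ≤ S.card := by
  obtain ⟨S, hS, hsign⟩ := exists_finset_roots_const_sign hP0 u v
  refine ⟨S, hS, ?_⟩
  by_contra! hcard
  -- With fewer than `n` factors the product is an admissible test polynomial, yet it makes the
  -- integrand of constant sign.
  have hz := integral_mul_eval_mul_weight_eq_zero hα hβ hγ ha h hP
    (Q := ∏ r ∈ S, (X - C r)) (by rwa [natDegree_finsetProd_X_sub_C_eq_card])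
  have hne : P * ∏ r ∈ S, (X - C r) ≠ 0 :=
    mul_ne_zero hP0 (monic_prod_of_monic S _ fun r _ => monic_X_sub_C r).ne_zero
  rcases hsign with hs | hs
  · exact (integral_eval_mul_weight_pos hα hβ hγ ha h hne hs).ne' hz
  · have := integral_eval_mul_weight_pos hα hβ hγ ha h (neg_ne_zero.2 hne)
      fun x hx => by rw [eval_neg]; exact neg_nonneg.2 (hs x hx)
    simp only [eval_neg, neg_mul, intervalIntegral.integral_neg, hz, neg_zero, lt_irrefl] at this

/-- The zeros forced on the two open intervals are disjoint, so together they outnumber the degree.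
This is the Angelesco argument and the source of every uniqueness claim below. -/
theorem eq_zero_of_orthogonal {α β γ a : ℝ} (hα : -1 < α) (hβ : -1 < β) (hγ : -1 < γ)
    (ha : a < 0) {n m : ℕ} {P : ℝ[X]} (hdeg : P.degree < (n + m : ℕ))
    (h1 : ∀ k < n, ∫ x in a..0, P.eval x * weight α β γ a x * x ^ k = 0)
    (h2 : ∀ k < m, ∫ x in (0 : ℝ)..1, P.eval x * weight α β γ a x * x ^ k = 0) : P = 0 := by
  by_contra hP
  obtain ⟨S, hS, hSn⟩ := exists_finset_roots_of_orthogonal hα hβ hγ ha (Or.inl ⟨rfl, rfl⟩) hP h1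
  obtain ⟨T, hT, hTm⟩ := exists_finset_roots_of_orthogonal hα hβ hγ ha (Or.inr ⟨rfl, rfl⟩) hP h2
  have hdisj : Disjoint S T := Finset.disjoint_left.2 fun r hr hr' =>
    absurd (hS r hr).1.2 (not_lt.2 (hT r hr').1.1.le)
  have hsub : S ∪ T ⊆ P.roots.toFinset := by
    intro r hr
    rw [Multiset.mem_toFinset, mem_roots hP]
    rcases Finset.mem_union.1 hr with hr | hr
    · exact (hS r hr).2
    · exact (hT r hr).2
  have c1 := Finset.card_le_card hsub
  have c2 := Multiset.toFinset_card_le P.roots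
  have c3 := card_roots' P
  have c4 := (natDegree_lt_iff_degree_lt hP).2 hdeg
  rw [Finset.card_union_of_disjoint hdisj] at c1
  omega

/-- The linear map sending a polynomial to its moment against the weight. -/
def moment (α β γ a u v : ℝ) (hα : -1 < α) (hβ : -1 < β) (hγ : -1 < γ)
    (ha : a < 0) (h : IsSide a u v) (k : ℕ) : ℝ[X] →ₗ[ℝ] ℝ where
  toFun P := ∫ x in u..v, P.eval x * weight α β γ a x * x ^ k
  map_add' P Q := by
    rw [← intervalIntegral.integral_add]
    · refine intervalIntegral.integral_congr fun x _ => ?_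
      simp only [eval_add]
      ring
    all_goals
      simp_rw [eval_mul_mul_pow]
      exact intervalIntegrable_eval_mul_weight hα hβ hγ ha h _
  map_smul' c P := by
    simp only [eval_smul, smul_eq_mul, RingHom.id_apply, mul_assoc,
      intervalIntegral.integral_const_mul]

/-- The `n + m` moment conditions on the `n + m` lower coefficients form a square system with
trivial kernel, hence solvable. -/
theorem exists_isTypeII {α β γ a : ℝ} (hα : -1 < α) (hβ : -1 < β) (hγ : -1 < γ)
    (ha : a < 0) (n m : ℕ) : ∃ Q, IsTypeII α β γ a n m Q := by
  let M1 := fun k => moment α β γ a a 0 hα hβ hγ ha (Or.inl ⟨rfl, rfl⟩) k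
  let M2 := fun k => moment α β γ a 0 1 hα hβ hγ ha (Or.inr ⟨rfl, rfl⟩) k
  let A : ℝ[X] →ₗ[ℝ] (Fin n → ℝ) × (Fin m → ℝ) :=
    (LinearMap.pi fun k : Fin n => M1 k).prod (LinearMap.pi fun k : Fin m => M2 k)
  let e := degreeLTEquiv ℝ (n + m)
  let B : (Fin (n + m) → ℝ) →ₗ[ℝ] (Fin n → ℝ) × (Fin m → ℝ) :=
    A ∘ₗ (degreeLT ℝ (n + m)).subtype ∘ₗ e.symm.toLinearMap
  have hA : ∀ P : ℝ[X], P.degree < (n + m : ℕ) → A P = 0 → P = 0 := by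
    intro P hd hP
    refine eq_zero_of_orthogonal hα hβ hγ ha hd (fun k hk => ?_) (fun k hk => ?_)
    · exact congrFun (congrArg Prod.fst hP) ⟨k, hk⟩
    · exact congrFun (congrArg Prod.snd hP) ⟨k, hk⟩
  have hinj : Function.Injective B := by
    rw [← LinearMap.ker_eq_bot, LinearMap.ker_eq_bot']
    intro c hc
    have := hA (e.symm c) (mem_degreeLT.1 (e.symm c).2) hc
    rwa [Submodule.coe_eq_zero, LinearEquiv.map_eq_zero_iff] at this
  have hsurj : Function.Surjective B := by
    refine (LinearMap.injective_iff_surjective_of_finrank_eq_finrank ?_).1 hinj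
    simp
  -- Solve for the lower-degree correction having the same moments as the leading monomial.
  obtain ⟨c, hc⟩ := hsurj (A (X ^ (n + m)))
  have hd := mem_degreeLT.1 (e.symm c).2
  have hz : A (X ^ (n + m) - (e.symm c : ℝ[X])) = 0 := by
    rw [map_sub, ← hc]
    exact sub_self _
  refine ⟨X ^ (n + m) - (e.symm c : ℝ[X]), monic_X_pow_sub hd, ?_,
    fun k hk => ?_, fun k hk => ?_⟩
  · refine natDegree_eq_of_degree_eq_some ?_
    rw [degree_sub_eq_left_of_degree_lt (by rwa [degree_X_pow]), degree_X_pow]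
  · exact congrFun (congrArg Prod.fst hz) ⟨k, hk⟩
  · exact congrFun (congrArg Prod.snd hz) ⟨k, hk⟩

theorem IsTypeII.unique {α β γ a : ℝ} (hα : -1 < α) (hβ : -1 < β) (hγ : -1 < γ)
    (ha : a < 0) {n m : ℕ} {P Q : ℝ[X]} (hP : IsTypeII α β γ a n m P)
    (hQ : IsTypeII α β γ a n m Q) : P = Q := by
  rw [← sub_eq_zero]
  refine eq_zero_of_orthogonal (n := n) (m := m) hα hβ hγ ha ?_ (fun k hk => ?_) (fun k hk => ?_)
  · rw [← hP.2.1, ← degree_eq_natDegree hP.1.ne_zero]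
    refine degree_sub_lt_left ?_ hP.1.ne_zero ?_
    · rw [degree_eq_natDegree hP.1.ne_zero, degree_eq_natDegree hQ.1.ne_zero, hP.2.1, hQ.2.1]
    · rw [hP.1, hQ.1]
  · have := (moment α β γ a a 0 hα hβ hγ ha (Or.inl ⟨rfl, rfl⟩) k).map_sub P Q
    exact this.trans (by rw [sub_eq_zero]; exact (hP.2.2.1 k hk).trans (hQ.2.2.1 k hk).symm)
  · have := (moment α β γ a 0 1 hα hβ hγ ha (Or.inr ⟨rfl, rfl⟩) k).map_sub P Q
    exact this.trans (by rw [sub_eq_zero]; exact (hP.2.2.2 k hk).trans (hQ.2.2.2 k hk).symm)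

theorem isTypeII_poly {α β γ a : ℝ} (hα : -1 < α) (hβ : -1 < β) (hγ : -1 < γ)
    (ha : a < 0) (n m : ℕ) : IsTypeII α β γ a n m (poly α β γ a n m) :=
  Classical.epsilon_spec (exists_isTypeII hα hβ hγ ha n m)

theorem poly_eq {α β γ a : ℝ} (hα : -1 < α) (hβ : -1 < β) (hγ : -1 < γ)
    (ha : a < 0) {n m : ℕ} {Q : ℝ[X]} (hQ : IsTypeII α β γ a n m Q) :
    poly α β γ a n m = Q :=
  (isTypeII_poly hα hβ hγ ha n m).unique hα hβ hγ ha hQ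

/-! ### Critical points of the cubic and the limit of `X_n`. -/

theorem deriv_cubic (a x : ℝ) : deriv (cubic a) x = 3 * x ^ 2 - 2 * (a + 1) * x + a := by
  have h : HasDerivAt (cubic a) (3 * x ^ 2 - 2 * (a + 1) * x + a) x := by
    have := (((hasDerivAt_id x).sub_const a).mul (hasDerivAt_id x)).mul
      ((hasDerivAt_id x).sub_const 1)
    refine this.congr_deriv ?_
    simp only [id, Pi.mul_apply]
    ring
  exact h.deriv

theorem existsUnique_deriv_cubic_left {a : ℝ} (ha : a < 0) :
    ∃! x₁ : ℝ, x₁ ∈ Icc a 0 ∧ deriv (cubic a) x₁ = 0 := by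
  simp only [deriv_cubic]
  have hc : ContinuousOn (fun x : ℝ => 3 * x ^ 2 - 2 * (a + 1) * x + a) (Icc a 0) := by fun_prop
  -- The derivative is `a² - a > 0` at `a` and `a < 0` at `0`.
  obtain ⟨x, hx, hx'⟩ := intermediate_value_Icc' ha.le hc
    (show (0 : ℝ) ∈ Icc _ _ from ⟨by simpa using ha.le, by nlinarith⟩)
  dsimp only at hx'
  refine ⟨x, ⟨hx, hx'⟩, ?_⟩
  rintro y ⟨hy, hy'⟩
  by_contra hne
  -- Two distinct zeros satisfy Vieta's relations; their product would be `a/3 < 0`, impossible for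
  -- numbers of equal sign.
  have h1 : 3 * (x + y) = 2 * (a + 1) := mul_left_cancel₀ (sub_ne_zero.2 hne)
    (by linear_combination hy' - hx')
  nlinarith [mul_nonneg_of_nonpos_of_nonpos hx.2 hy.2]

theorem existsUnique_deriv_cubic_right {a : ℝ} (ha : a < 0) :
    ∃! x₂ : ℝ, x₂ ∈ Icc (0 : ℝ) 1 ∧ deriv (cubic a) x₂ = 0 := by
  simp only [deriv_cubic]
  have hc : ContinuousOn (fun x : ℝ => 3 * x ^ 2 - 2 * (a + 1) * x + a) (Icc 0 1) := by fun_prop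
  obtain ⟨x, hx, hx'⟩ := intermediate_value_Icc zero_le_one hc
    (show (0 : ℝ) ∈ Icc _ _ from ⟨by simpa using ha.le, by linarith⟩)
  dsimp only at hx'
  refine ⟨x, ⟨hx, hx'⟩, ?_⟩
  rintro y ⟨hy, hy'⟩
  by_contra hne
  have h1 : 3 * (x + y) = 2 * (a + 1) := mul_left_cancel₀ (sub_ne_zero.2 hne)
    (by linear_combination hy' - hx')
  nlinarith [mul_nonneg hx.1 hy.1]

/-- The horizontal tangent at `x` meets the graph doubly at `x` and once more at `a + 1 - 2x`, which
is positive; so the cubic lies below that tangent on the rest of the nonpositive axis. -/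
theorem cubic_lt_of_deriv_eq_zero {a x y : ℝ} (ha : a < 0) (hx : x ≤ 0)
    (h : deriv (cubic a) x = 0) (hy : y ≤ 0) (hne : y ≠ x) : cubic a y < cubic a x := by
  rw [deriv_cubic] at h
  have hx0 : x < 0 := lt_of_le_of_ne hx (by rintro rfl; simp at h; exact ha.ne h)
  have hz : 0 < a + 1 - 2 * x := by
    by_contra! hcon
    nlinarith [mul_nonneg_of_nonpos_of_nonpos hcon hx0.le, sq_nonneg x]
  have e : cubic a x - cubic a y = (y - x) ^ 2 * (a + 1 - 2 * x - y) := by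
    unfold cubic
    linear_combination (x - y) * h
  have : 0 < (y - x) ^ 2 * (a + 1 - 2 * x - y) :=
    mul_pos (sq_pos_of_ne_zero (sub_ne_zero.2 hne)) (by linarith)
  linarith

theorem weight_add_natCast {α β γ a x : ℝ} (hx : x ∈ Ioo a 0) (n : ℕ) :
    weight (α + n) (β + n) (γ + n) a x = cubic a x ^ n * weight α β γ a x := by
  have h2 : 0 < |x| := abs_pos.2 hx.2.ne
  unfold weight cubic
  rw [Real.rpow_add_natCast (by linarith [hx.1]), Real.rpow_add_natCast h2.ne',
    Real.rpow_add_natCast (by linarith [hx.2])]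
  have e : (x - a) * x * (x - 1) = (x - a) * |x| * (1 - x) := by
    rw [abs_of_neg hx.2]; ring
  rw [e, mul_pow, mul_pow]
  ring

theorem integral_mul_weight_add_natCast {α β γ a : ℝ} (ha : a < 0) (n : ℕ) (f : ℝ → ℝ) :
    ∫ x in a..0, f x * weight (α + n) (β + n) (γ + n) a x =
      ∫ x in Icc a 0, cubic a x ^ n • (f x * weight α β γ a x) := by
  rw [intervalIntegral.integral_of_le ha.le, integral_Ioc_eq_integral_Ioo,
    integral_Icc_eq_integral_Ioo]
  refine setIntegral_congr_fun measurableSet_Ioo fun x hx => ?_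
  simp only [weight_add_natCast hx, smul_eq_mul]
  ring

/-- Laplace's method: `gⁿ` concentrates at the unique maximum of `g` on `[a, 0]`, an interior point
where `w` is positive and continuous. -/
theorem tendsto_ratioX {α β γ a x₁ : ℝ} (hα : -1 < α) (hβ : -1 < β) (hγ : -1 < γ)
    (ha : a < 0) (hx₁ : x₁ ∈ Icc a 0) (h : deriv (cubic a) x₁ = 0) :
    Tendsto (ratioX α β γ a) atTop (𝓝 x₁) := by
  have h' := h
  rw [deriv_cubic] at h'
  have hx0 : x₁ < 0 := lt_of_le_of_ne hx₁.2 (by rintro rfl; simp at h'; exact ha.ne h')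
  have hxa : a < x₁ := lt_of_le_of_ne hx₁.1 (by rintro rfl; nlinarith)
  have hpos : 0 < cubic a x₁ := by
    have := cubic_lt_of_deriv_eq_zero ha hx0.le h le_rfl hx0.ne'
    simpa [cubic] using this
  have hwpos : 0 < weight α β γ a x₁ := weight_pos ha (Or.inl ⟨rfl, rfl⟩) ⟨hxa, hx0⟩
  have hwc : ContinuousAt (weight α β γ a) x₁ := by
    unfold weight
    refine ((ContinuousAt.rpow_const (by fun_prop) (Or.inl ?_)).mul
      (ContinuousAt.rpow_const (by fun_prop) (Or.inl ?_))).mul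
      (ContinuousAt.rpow_const (by fun_prop) (Or.inl ?_))
    · linarith
    · exact (abs_pos.2 hx0.ne).ne'
    · linarith
  have key : ∀ Q : ℝ[X], Tendsto (fun n : ℕ => (∫ x in Icc a 0, cubic a x ^ n)⁻¹ *
      ∫ x in a..0, Q.eval x * weight (α + n) (β + n) (γ + n) a x) atTop
      (𝓝 (Q.eval x₁ * weight α β γ a x₁)) := by
    intro Q
    simp_rw [integral_mul_weight_add_natCast ha _ (fun x => Q.eval x),
        ← smul_eq_mul (a := Inv.inv _)]
    refine tendsto_setIntegral_pow_smul_of_unique_maximum_of_isCompact_of_integrableOn isCompact_Icc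
      (by unfold cubic; fun_prop) (fun y hy hne => cubic_lt_of_deriv_eq_zero ha hx0.le h hy.2 hne)
      (fun y hy => ?_) hpos ?_ ?_ ?_
    · unfold cubic
      have : 0 ≤ (y - a) * (-y) * (1 - y) :=
        mul_nonneg (mul_nonneg (by linarith [hy.1]) (by linarith [hy.2])) (by linarith [hy.2])
      linarith
    · rw [interior_Icc, closure_Ioo ha.ne]
      exact hx₁
    · exact (intervalIntegrable_iff_integrableOn_Icc_of_le ha.le).1
        (intervalIntegrable_eval_mul_weight hα hβ hγ ha (Or.inl ⟨rfl, rfl⟩) Q)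
    · exact (Q.continuous.continuousAt.mul hwc).continuousWithinAt
  -- Numerator and denominator share the normalisation by the integral of `gⁿ`, which cancels in the
  -- quotient.
  have kX := key X
  have k1 := key 1
  simp only [eval_X, eval_one, one_mul] at kX k1
  have hdiv := kX.div k1 hwpos.ne'
  rw [mul_div_cancel_right₀ _ hwpos.ne'] at hdiv
  refine hdiv.congr' ?_
  filter_upwards [k1.eventually_ne hwpos.ne'] with n hn
  exact mul_div_mul_left _ _ (left_ne_zero_of_mul hn)

/-! ### The raising operator on polynomials, and `P_{n+1,n}` through the diagonal. -/

theorem poly_one_zero {α β γ a : ℝ} (hα : -1 < α) (hβ : -1 < β) (hγ : -1 < γ)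
    (ha : a < 0) (n : ℕ) :
    poly (α + n) (β + n) (γ + n) a 1 0 = X - C (ratioX α β γ a n) := by
  have hn : (0 : ℝ) ≤ n := n.cast_nonneg
  have hα' : -1 < α + n := by linarith
  have hβ' : -1 < β + n := by linarith
  have hγ' : -1 < γ + n := by linarith
  have hs : IsSide a a 0 := Or.inl ⟨rfl, rfl⟩
  refine poly_eq hα' hβ' hγ' ha ⟨monic_X_sub_C _, natDegree_X_sub_C _, fun k hk => ?_, by simp⟩
  obtain rfl : k = 0 := by omega
  have hpos := integral_eval_mul_weight_pos hα' hβ' hγ' ha hs one_ne_zero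
    (fun x _ => by rw [eval_one]; exact zero_le_one)
  have hi := intervalIntegrable_weight hα' hβ' hγ' ha hs
  have hX := intervalIntegrable_eval_mul_weight hα' hβ' hγ' ha hs X
  simp only [eval_X, eval_one, one_mul] at hX hpos
  simp only [eval_sub, eval_X, eval_C, pow_zero, mul_one, sub_mul]
  rw [intervalIntegral.integral_sub hX (hi.const_mul _), intervalIntegral.integral_const_mul,
    ratioX, div_mul_cancel₀ _ hpos.ne', sub_self]

/-- A factor `x` can be absorbed into the weight, where it raises `β` by one. This is how `β + 1`
enters the formula for `P_{n+1,n}`. -/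
theorem raise_X_mul (α β γ a : ℝ) (p : ℝ[X]) :
    raise α β γ a (X * p) = X * raise α (β + 1) γ a p := by
  simp only [raise, derivative_mul, derivative_X, map_add, map_one]
  ring

theorem raise_C_mul (α β γ a c : ℝ) (p : ℝ[X]) :
    raise α β γ a (C c * p) = C c * raise α β γ a p := by
  simp only [raise, derivative_mul, derivative_C]
  ring

theorem raise_sub (α β γ a : ℝ) (p q : ℝ[X]) :
    raise α β γ a (p - q) = raise α β γ a p - raise α β γ a q := by
  simp only [raise, derivative_sub]
  ring

theorem coeff_raise (α β γ a : ℝ) (p : ℝ[X]) (m : ℕ) :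
    (raise α β γ a p).coeff (m + 2) = (m + (α + β + γ + 3)) * p.coeff m
      - ((m + 1) * (a + 1) + (α + 1 + (β + 1) * (1 + a) + (γ + 1) * a)) * p.coeff (m + 1)
      + a * (m + 2 + (β + 1)) * p.coeff (m + 2) := by
  have e : raise α β γ a p = X * (X * (X * derivative p)) - C (a + 1) * (X * (X * derivative p))
      + C a * (X * derivative p) + C (α + β + γ + 3) * (X * (X * p))
      - C (α + 1 + (β + 1) * (1 + a) + (γ + 1) * a) * (X * p) + C (a * (β + 1)) * p := by
    have h3 : (C (3 : ℝ) : ℝ[X]) = 3 := rfl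
    simp only [raise, map_add, map_mul, map_one, h3]
    ring
  rw [e]
  simp only [coeff_add, coeff_sub, coeff_C_mul, coeff_X_mul]
  rcases m with _ | m
  · simp [coeff_derivative]
    ring
  · simp only [coeff_X_mul, coeff_derivative]
    push_cast
    ring

/-- Moving `x³` through the operator lowers `β` by 3. The value `β - 3` need not exceed `-1`, but
the operator is purely algebraic. -/
theorem coeff_X_pow_three_mul_raise (α β γ a : ℝ) (p : ℝ[X]) (m : ℕ) :
    (X ^ 3 * raise α β γ a p).coeff (m + 2) = (m + (α + β + γ)) * (X ^ 3 * p).coeff m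
      - ((m + 1) * (a + 1) + (α + 1 + (β - 2) * (1 + a) + (γ + 1) * a)) * (X ^ 3 * p).coeff (m + 1)
      + a * (m + β) * (X ^ 3 * p).coeff (m + 2) := by
  have e : X ^ 3 * raise α β γ a p = raise α (β - 3) γ a (X ^ 3 * p) := by
    have e1 : X ^ 3 * p = X * (X * (X * p)) := by ring
    rw [e1, raise_X_mul, raise_X_mul, raise_X_mul]
    have e2 : β - 3 + 1 + 1 + 1 = β := by ring
    rw [e2]
    ring
  rw [e, coeff_raise]
  ring

theorem natDegree_raise_le {α β γ a : ℝ} {p : ℝ[X]} {n : ℕ} (hp : p.natDegree ≤ n) :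
    (raise α β γ a p).natDegree ≤ n + 2 := by
  rw [natDegree_le_iff_coeff_eq_zero]
  intro N hN
  obtain ⟨m, rfl⟩ : ∃ m, N = m + 2 := ⟨N - 2, by omega⟩
  rw [coeff_raise, coeff_eq_zero_of_natDegree_lt (show p.natDegree < m by omega),
    coeff_eq_zero_of_natDegree_lt (show p.natDegree < m + 1 by omega),
    coeff_eq_zero_of_natDegree_lt (show p.natDegree < m + 2 by omega)]
  ring

theorem coeff_raise_add_two {α β γ a : ℝ} {p : ℝ[X]} {n : ℕ} (hp : p.natDegree = n)
    (hm : p.Monic) : (raise α β γ a p).coeff (n + 2) = α + β + γ + n + 3 := by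
  rw [coeff_raise, coeff_eq_zero_of_natDegree_lt (show p.natDegree < n + 1 by omega),
    coeff_eq_zero_of_natDegree_lt (show p.natDegree < n + 2 by omega), ← hp,
    hm.coeff_natDegree]
  ring

/-- The raising operator sends `P_{n,m}` with raised parameters to a multiple of `P_{n+1,m+1}`. -/
theorem C_mul_poly_succ_succ {α β γ a : ℝ} (hα : -1 < α) (hβ : -1 < β) (hγ : -1 < γ)
    (ha : a < 0) (n m : ℕ) :
    C (α + β + γ + n + m + 3) * poly α β γ a (n + 1) (m + 1) =
      raise α β γ a (poly (α + 1) (β + 1) (γ + 1) a n m) := by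
  obtain ⟨hmon, hdeg, h1, h2⟩ := isTypeII_poly (show -1 < α + 1 by linarith)
    (show -1 < β + 1 by linarith) (show -1 < γ + 1 by linarith) ha n m
  set p := poly (α + 1) (β + 1) (γ + 1) a n m with hp
  have hn : (0 : ℝ) ≤ n := n.cast_nonneg
  have hm : (0 : ℝ) ≤ m := m.cast_nonneg
  have hc : α + β + γ + n + m + 3 ≠ 0 := by
    have : 0 < α + β + γ + n + m + 3 := by linarith
    exact this.ne'
  have hcoeff := coeff_raise_add_two (α := α) (β := β) (γ := γ) (a := a) hdeg hmon
  have hle := natDegree_raise_le (α := α) (β := β) (γ := γ) (a := a) hdeg.le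
  push_cast at hcoeff
  have hscale : ∀ u v : ℝ, ∀ k : ℕ,
      (∫ x in u..v, (raise α β γ a p).eval x * weight α β γ a x * x ^ k = 0) →
      ∫ x in u..v, (C (α + β + γ + n + m + 3)⁻¹ * raise α β γ a p).eval x *
        weight α β γ a x * x ^ k = 0 := by
    intro u v k h
    simp only [eval_mul, eval_C, mul_assoc] at h ⊢
    rw [intervalIntegral.integral_const_mul, h, mul_zero]
  have key : IsTypeII α β γ a (n + 1) (m + 1)
      (C (α + β + γ + n + m + 3)⁻¹ * raise α β γ a p) := by
    have hcoeff' : (C (α + β + γ + n + m + 3)⁻¹ * raise α β γ a p).coeff (n + m + 2) = 1 := by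
      rw [coeff_C_mul, hcoeff, ← add_assoc]
      exact inv_mul_cancel₀ hc
    have hle' : (C (α + β + γ + n + m + 3)⁻¹ * raise α β γ a p).natDegree ≤ n + m + 2 :=
      (natDegree_C_mul_le _ _).trans hle
    refine ⟨monic_of_natDegree_le_of_coeff_eq_one _ hle' hcoeff', ?_, fun k hk => ?_,
      fun k hk => ?_⟩
    · have := natDegree_eq_of_le_of_coeff_ne_zero hle' (by rw [hcoeff']; exact one_ne_zero)
      omega
    · exact hscale _ _ _ (integral_raise_mul_pow hα hβ hγ ha (Or.inl ⟨rfl, rfl⟩) p h1 k hk)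
    · exact hscale _ _ _ (integral_raise_mul_pow hα hβ hγ ha (Or.inr ⟨rfl, rfl⟩) p h2 k hk)
  rw [poly_eq hα hβ hγ ha key, ← mul_assoc, ← C_mul, mul_inv_cancel₀ hc, C_1, one_mul]

theorem poly_zero_zero {α β γ a : ℝ} (hα : -1 < α) (hβ : -1 < β) (hγ : -1 < γ)
    (ha : a < 0) : poly α β γ a 0 0 = 1 :=
  poly_eq hα hβ hγ ha ⟨monic_one, natDegree_one, by simp, by simp⟩

theorem ratioX_add_one (α β γ a : ℝ) (n : ℕ) :
    ratioX (α + 1) (β + 1) (γ + 1) a n = ratioX α β γ a (n + 1) := by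
  unfold ratioX
  push_cast
  simp only [add_assoc, add_comm (1 : ℝ)]

/-- Apply the raising operator to the identity for the parameters increased by 1. The factor `s + 3n
+ 1` is invariant under this step and is kept as a multiplier, because it may vanish when `n = 0`.
-/
theorem C_mul_poly_succ_self {α β γ a : ℝ} (hα : -1 < α) (hβ : -1 < β) (hγ : -1 < γ)
    (ha : a < 0) (n : ℕ) :
    C (α + β + γ + 3 * n + 1) * poly α β γ a (n + 1) n =
      C (α + β + γ + 3 * n + 1) * (X * poly α (β + 1) γ a n n)
        - C ((α + β + γ + 2 * n + 1) * ratioX α β γ a n) * poly α β γ a n n := by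
  induction n generalizing α β γ with
  | zero =>
    have h := poly_one_zero hα hβ hγ ha 0
    simp only [Nat.cast_zero, add_zero] at h
    rw [zero_add, h, poly_zero_zero hα hβ hγ ha, poly_zero_zero hα (by linarith) hγ ha]
    simp only [Nat.cast_zero, mul_zero, add_zero, C_mul]
    ring
  | succ n ih =>
    have ih' := congrArg (raise α β γ a) (ih (show -1 < α + 1 by linarith)
      (show -1 < β + 1 by linarith) (show -1 < γ + 1 by linarith))
    have hn : (0 : ℝ) ≤ n := n.cast_nonneg
    have e1 := C_mul_poly_succ_succ hα hβ hγ ha (n + 1) n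
    have e2 := C_mul_poly_succ_succ hα hβ hγ ha n n
    have e3 := C_mul_poly_succ_succ hα (show -1 < β + 1 by linarith) hγ ha n n
    rw [raise_sub, raise_C_mul, raise_C_mul, raise_C_mul, raise_X_mul, ← e1, ← e2, ← e3,
      ratioX_add_one] at ih'
    have hc : α + β + γ + 2 * n + 4 ≠ 0 := by
      have : 0 < α + β + γ + 2 * n + 4 := by linarith
      exact this.ne'
    -- This is the normalising constant of both `P_{n+2,n+1}` and the `β + 1` diagonal term, and
    -- also the factor in front of `X_n` in the induction hypothesis; hence it cancels.
    have hc' : (C (α + β + γ + 2 * n + 4) : ℝ[X]) ≠ 0 := C_ne_zero.2 hc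
    refine mul_left_cancel₀ hc' ?_
    have c1 : α + β + γ + ((n + 1 : ℕ) : ℝ) + n + 3 = α + β + γ + 2 * n + 4 := by push_cast; ring
    have c2 : α + (β + 1) + γ + (n : ℝ) + n + 3 = α + β + γ + 2 * n + 4 := by ring
    have c3 : α + 1 + (β + 1) + (γ + 1) + 3 * (n : ℝ) + 1 = α + β + γ + 3 * ((n + 1 : ℕ) : ℝ) +
        1 := by
      push_cast; ring
    have c4 : α + 1 + (β + 1) + (γ + 1) + 2 * (n : ℝ) + 1 = α + β + γ + 2 * n + 4 := by ring
    have c5 : α + β + γ + 2 * ((n + 1 : ℕ) : ℝ) + 1 = α + β + γ + n + n + 3 := by push_cast; ring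
    rw [c1, c2, c3, c4] at ih'
    rw [c5]
    simp only [C_mul] at ih' ⊢
    linear_combination ih'

/-! ### Leading coefficients of the diagonal polynomials, from the Rodrigues expansion at infinity.
-/

/-! The coefficients of `x⁻¹`, `x⁻²`, `x⁻³` in `(1 - a/x)^A (1 - 1/x)^C`. -/

def expand₁ (A C a : ℝ) : ℝ := -(a * A + C)

def expand₂ (A C a : ℝ) : ℝ := a ^ 2 * A * (A - 1) / 2 + a * A * C + C * (C - 1) / 2

def expand₃ (A C a : ℝ) : ℝ :=
  -(a ^ 3 * A * (A - 1) * (A - 2) / 6 + a ^ 2 * A * (A - 1) / 2 * C + a * A * C * (C - 1) / 2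
    + C * (C - 1) * (C - 2) / 6)

/-- `N` times the coefficient of `x^(2n-1)` in `P_{n,n}`, where `A = α + n`, `C = γ + n` and
`N = α + β + γ + 3n`. -/
def numer₁ (A C N n a : ℝ) : ℝ := N * expand₁ (n - A) (n - C) a + (N - n) * expand₁ A C a

/-- `N (N - 1)` times the coefficient of `x^(2n-2)` in `P_{n,n}`. -/
def numer₂ (A C N n a : ℝ) : ℝ :=
  N * (N - 1) * expand₂ (n - A) (n - C) a
    + (N - 1) * (N - n) * expand₁ A C a * expand₁ (n - A) (n - C) a
    + (N - n) * (N - n - 1) * expand₂ A C a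

/-- `N (N - 1) (N - 2)` times the coefficient of `x^(2n-3)` in `P_{n,n}`. -/
def numer₃ (A C N n a : ℝ) : ℝ :=
  N * (N - 1) * (N - 2) * expand₃ (n - A) (n - C) a
    + (N - 1) * (N - 2) * (N - n) * expand₁ A C a * expand₂ (n - A) (n - C) a
    + (N - 2) * (N - n) * (N - n - 1) * expand₂ A C a * expand₁ (n - A) (n - C) a
    + (N - n) * (N - n - 1) * (N - n - 2) * expand₃ A C a

/-- The leading coefficients of `P_{n,n}`; the factor `x³` avoids negative exponents. -/
theorem coeff_poly_self {α β γ a : ℝ} (hα : -1 < α) (hβ : -1 < β) (hγ : -1 < γ)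
    (ha : a < 0) (n : ℕ) {A C N : ℝ} (hA : A = α + n) (hC : C = γ + n)
    (hN : N = α + β + γ + 3 * n) :
    N * (X ^ 3 * poly α β γ a n n).coeff (2 * n + 2) = numer₁ A C N n a ∧
    N * (N - 1) * (X ^ 3 * poly α β γ a n n).coeff (2 * n + 1) = numer₂ A C N n a ∧
    N * (N - 1) * (N - 2) * (X ^ 3 * poly α β γ a n n).coeff (2 * n) = numer₃ A C N n a := by
  induction n generalizing α β γ with
  | zero =>
    rw [poly_zero_zero hα hβ hγ ha]
    simp only [coeff_X_pow, mul_one, numer₁, numer₂, numer₃, expand₁, expand₂, expand₃]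
    norm_num
    refine ⟨?_, ?_, ?_⟩ <;> ring
  | succ n ih =>
    have hn : (0 : ℝ) ≤ n := n.cast_nonneg
    push_cast at hA hC hN
    -- `A`, `C` and `N` do not change when the parameters go up by 1 and `n` goes down by 1, so only
    -- `n` varies along the induction.
    obtain ⟨ih1, ih2, ih3⟩ := ih (show -1 < α + 1 by linarith)
      (show -1 < β + 1 by linarith) (show -1 < γ + 1 by linarith) (by rw [hA]; ring)
      (by rw [hC]; ring) (by rw [hN]; ring)
    obtain ⟨hmon, hdeg, -⟩ := isTypeII_poly (show -1 < α + 1 by linarith)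
      (show -1 < β + 1 by linarith) (show -1 < γ + 1 by linarith) ha n n
    have hc : N - n ≠ 0 := by
      have : 0 < N - n := by linarith
      exact this.ne'
    have e0 := C_mul_poly_succ_succ hα hβ hγ ha n n
    have e : ∀ k, (N - n) * (X ^ 3 * poly α β γ a (n + 1) (n + 1)).coeff k =
        (X ^ 3 * raise α β γ a (poly (α + 1) (β + 1) (γ + 1) a n n)).coeff k := by
      intro k
      rw [← e0, ← coeff_C_mul]
      congr 1
      rw [show α + β + γ + n + n + 3 = N - n by rw [hN]; ring]
      ring
    set p := poly (α + 1) (β + 1) (γ + 1) a n n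
    have u4 : (X ^ 3 * p).coeff (2 * n + 1 + 3) = 0 := by
      rw [coeff_X_pow_mul]
      exact coeff_eq_zero_of_natDegree_lt (by omega)
    have u3 : (X ^ 3 * p).coeff (2 * n + 3) = 1 := by
      rw [coeff_X_pow_mul, two_mul, ← hdeg]
      exact hmon
    -- Passing to `A`, `C`, `N` as free variables makes the induction step a polynomial identity.
    obtain rfl : α = A - (n + 1) := by linarith
    obtain rfl : γ = C - (n + 1) := by linarith
    obtain rfl : β = N - A - C - (n + 1) := by linarith
    have q1 := (e (2 * n + 2 + 2)).trans (coeff_X_pow_three_mul_raise _ _ _ _ _ _)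
    have q2 := (e (2 * n + 1 + 2)).trans (coeff_X_pow_three_mul_raise _ _ _ _ _ _)
    have q3 := (e (2 * n + 2)).trans (coeff_X_pow_three_mul_raise _ _ _ _ _ _)
    push_cast at q1 q2 q3
    rw [show 2 * n + 2 + 2 = 2 * n + 1 + 3 by ring, show 2 * n + 2 + 1 = 2 * n + 3 by ring, u4, u3]
      at q1
    rw [show 2 * n + 1 + 2 = 2 * n + 3 by ring, show 2 * n + 1 + 1 = 2 * n + 2 by ring, u3] at q2
    rw [show 2 * (n + 1) + 2 = 2 * n + 1 + 3 by ring, show 2 * (n + 1) + 1 = 2 * n + 3 by ring,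
      show 2 * (n + 1) = 2 * n + 2 by ring]
    generalize (X ^ 3 * p).coeff (2 * n + 2) = v1 at *
    generalize (X ^ 3 * p).coeff (2 * n + 1) = v2 at *
    generalize (X ^ 3 * p).coeff (2 * n) = v3 at *
    simp only [numer₁, numer₂, numer₃, expand₁, expand₂, expand₃] at *
    push_cast
    refine ⟨mul_left_cancel₀ hc ?_, mul_left_cancel₀ hc ?_, mul_left_cancel₀ hc ?_⟩
    · linear_combination N * q1 + (N - n - 1) * ih1
    · linear_combination N * (N - 1) * q2 + (N - n - 2) * ih2
        - (N - 1) * ((2 * n + 2) * (a + 1)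
          + (A - (n + 1) + 1 + (N - A - C - (n + 1) - 2) * (1 + a) + (C - (n + 1) + 1) * a)) * ih1
    · linear_combination N * (N - 1) * (N - 2) * q3 + (N - n - 3) * ih3
        - (N - 2) * ((2 * n + 1) * (a + 1)
          + (A - (n + 1) + 1 + (N - A - C - (n + 1) - 2) * (1 + a) + (C - (n + 1) + 1) * a)) * ih2
        + (N - 1) * (N - 2) * a * (2 * n + (N - A - C - (n + 1))) * ih1

/-! ### The four-term recurrence and its coefficients in terms of leading coefficients. -/

theorem isTypeII_seq {α β γ a : ℝ} (hα : -1 < α) (hβ : -1 < β) (hγ : -1 < γ)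
    (ha : a < 0) (k : ℕ) : IsTypeII α β γ a ((k + 1) / 2) (k / 2) (seq α β γ a k) :=
  isTypeII_poly hα hβ hγ ha _ _

theorem monic_seq {α β γ a : ℝ} (hα : -1 < α) (hβ : -1 < β) (hγ : -1 < γ)
    (ha : a < 0) (k : ℕ) : (seq α β γ a k).Monic :=
  (isTypeII_seq hα hβ hγ ha k).1

theorem natDegree_seq {α β γ a : ℝ} (hα : -1 < α) (hβ : -1 < β) (hγ : -1 < γ)
    (ha : a < 0) (k : ℕ) : (seq α β γ a k).natDegree = k := by
  rw [(isTypeII_seq hα hβ hγ ha k).2.1]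
  omega

theorem degree_sub_C_mul_lt {p q : ℝ[X]} {k : ℕ} (hp : p.degree < (k + 1 : ℕ)) (hq : q.Monic)
    (hk : q.natDegree = k) : (p - C (p.coeff k) * q).degree < (k : ℕ) := by
  rw [degree_lt_iff_coeff_zero] at hp ⊢
  intro m hm
  rw [coeff_sub, coeff_C_mul]
  rcases eq_or_lt_of_le hm with rfl | hm
  · have : q.coeff k = 1 := by rw [← hk]; exact hq
    rw [this]
    ring
  · rw [hp m hm, coeff_eq_zero_of_natDegree_lt (hk.trans_lt hm)]
    ring

/-- Orthogonality on `[a, 0]` up to `n` and on `[0, 1]` up to `m`, as a submodule. -/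
def orthogonal (α β γ a : ℝ) (hα : -1 < α) (hβ : -1 < β) (hγ : -1 < γ) (ha : a < 0)
    (n m : ℕ) : Submodule ℝ ℝ[X] :=
  (⨅ k : Fin n, LinearMap.ker (moment α β γ a a 0 hα hβ hγ ha (Or.inl ⟨rfl, rfl⟩) k)) ⊓
    ⨅ k : Fin m, LinearMap.ker (moment α β γ a 0 1 hα hβ hγ ha (Or.inr ⟨rfl, rfl⟩) k)

theorem mem_orthogonal {α β γ a : ℝ} {hα : -1 < α} {hβ : -1 < β} {hγ : -1 < γ} {ha : a < 0}
    {n m : ℕ} {P : ℝ[X]} : P ∈ orthogonal α β γ a hα hβ hγ ha n m ↔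
      (∀ k < n, ∫ x in a..0, P.eval x * weight α β γ a x * x ^ k = 0) ∧
      (∀ k < m, ∫ x in (0 : ℝ)..1, P.eval x * weight α β γ a x * x ^ k = 0) := by
  simp only [orthogonal, Submodule.mem_inf, Submodule.mem_iInf, LinearMap.mem_ker, Fin.forall_iff]
  rfl

theorem C_mul_mem_orthogonal {α β γ a : ℝ} {hα : -1 < α} {hβ : -1 < β} {hγ : -1 < γ} {ha : a < 0}
    {n m : ℕ} {P : ℝ[X]} (hP : P ∈ orthogonal α β γ a hα hβ hγ ha n m) (c : ℝ) :
    C c * P ∈ orthogonal α β γ a hα hβ hγ ha n m := by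
  rw [← smul_eq_C_mul]
  exact Submodule.smul_mem _ _ hP

theorem IsTypeII.mem_orthogonal {α β γ a : ℝ} (hα : -1 < α) (hβ : -1 < β) (hγ : -1 < γ)
    (ha : a < 0) {n m n' m' : ℕ} {P : ℝ[X]} (hP : IsTypeII α β γ a n m P) (hn : n' ≤ n)
    (hm : m' ≤ m) : P ∈ orthogonal α β γ a hα hβ hγ ha n' m' :=
  JacobiAngelesco.mem_orthogonal.2 ⟨fun k hk => hP.2.2.1 k (by omega),
    fun k hk => hP.2.2.2 k (by omega)⟩

theorem IsTypeII.X_mul_mem_orthogonal {α β γ a : ℝ} (hα : -1 < α) (hβ : -1 < β) (hγ : -1 < γ)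
    (ha : a < 0) {n m n' m' : ℕ} {P : ℝ[X]} (hP : IsTypeII α β γ a n m P) (hn : n' + 1 ≤ n)
    (hm : m' + 1 ≤ m) : X * P ∈ orthogonal α β γ a hα hβ hγ ha n' m' := by
  have e : ∀ k : ℕ, ∀ x : ℝ, (X * P).eval x * weight α β γ a x * x ^ k =
      P.eval x * weight α β γ a x * x ^ (k + 1) := fun k x => by
    rw [eval_mul, eval_X]
    ring
  refine JacobiAngelesco.mem_orthogonal.2 ⟨fun k hk => ?_, fun k hk => ?_⟩
  · simp_rw [e]
    exact hP.2.2.1 _ (by omega)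
  · simp_rw [e]
    exact hP.2.2.2 _ (by omega)

/-- Subtract multiples of the step-line polynomials to lower the degree of `x P_k`. After `P_{k-2}`
the remainder has degree below `k - 2` and still satisfies `k - 2` orthogonality conditions, so it
is zero. -/
theorem exists_recurrence {α β γ a : ℝ} (hα : -1 < α) (hβ : -1 < β) (hγ : -1 < γ)
    (ha : a < 0) : ∃ b c d : ℕ → ℝ, IsRecurrence α β γ a b c d := by
  have key : ∀ k : ℕ, ∃ b c d : ℝ, X * seq α β γ a k = seq α β γ a (k + 1) + C b * seq α β γ a k
      + (if 1 ≤ k then C c * seq α β γ a (k - 1) else 0)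
      + (if 2 ≤ k then C d * seq α β γ a (k - 2) else 0) := by
    intro k
    have hm := monic_seq hα hβ hγ ha
    have hd := natDegree_seq hα hβ hγ ha
    have d0 : (X * seq α β γ a k - seq α β γ a (k + 1)).degree < ((k + 1 : ℕ) : WithBot ℕ) := by
      have hXm : (X * seq α β γ a k).Monic := monic_X.mul (hm k)
      have hXd : (X * seq α β γ a k).natDegree = k + 1 := by
        rw [monic_X.natDegree_mul (hm k), natDegree_X, hd]
        ring
      have := degree_sub_C_mul_lt (p := X * seq α β γ a k) (k := k + 1) (by
        rw [degree_eq_natDegree hXm.ne_zero, hXd]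
        exact_mod_cast Nat.lt_succ_self _) (hm (k + 1)) (hd (k + 1))
      have hcoeff : (X * seq α β γ a k).coeff (k + 1) = 1 := by
        rw [← hXd]
        exact hXm
      rwa [hcoeff, C_1, one_mul] at this
    have d1 := degree_sub_C_mul_lt d0 (hm k) (hd k)
    set R1 := X * seq α β γ a k - seq α β γ a (k + 1) -
      C ((X * seq α β γ a k - seq α β γ a (k + 1)).coeff k) * seq α β γ a k with hR1
    -- For `k = 0, 1` the degree alone forces the remainder to vanish.
    rcases k with _ | _ | k
    · have : R1 = 0 := by simpa using d1
      refine ⟨(X * seq α β γ a 0 - seq α β γ a (0 + 1)).coeff 0, 0, 0, ?_⟩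
      rw [if_neg (by omega), if_neg (by omega)]
      rw [hR1] at this
      linear_combination this
    · have d2 := degree_sub_C_mul_lt d1 (hm 0) (hd 0)
      have : R1 - C (R1.coeff 0) * seq α β γ a 0 = 0 := by simpa using d2
      refine ⟨(X * seq α β γ a 1 - seq α β γ a (1 + 1)).coeff 1, R1.coeff 0, 0, ?_⟩
      simp only [zero_add, le_refl, if_true, Nat.sub_self, show ¬ (2 ≤ 1) by norm_num, if_false,
        add_zero]
      rw [hR1] at this
      simp only [zero_add] at this
      linear_combination this
    · have d2 := degree_sub_C_mul_lt d1 (hm (k + 1)) (hd (k + 1))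
      set R2 := R1 - C (R1.coeff (k + 1)) * seq α β γ a (k + 1) with hR2
      have d3 := degree_sub_C_mul_lt d2 (hm k) (hd k)
      have hs := isTypeII_seq hα hβ hγ ha
      set n := (k + 1) / 2 with hn
      set m := k / 2 with hm'
      have hmem : R2 - C (R2.coeff k) * seq α β γ a k ∈ orthogonal α β γ a hα hβ hγ ha n m := by
        refine Submodule.sub_mem _ (Submodule.sub_mem _ (Submodule.sub_mem _ (Submodule.sub_mem _
          ?_ ?_) (C_mul_mem_orthogonal ?_ _)) (C_mul_mem_orthogonal ?_ _))
          (C_mul_mem_orthogonal ?_ _)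
        -- Multiplication by `x` costs one order on each interval, which two steps along the line
        -- exactly compensate.
        · exact (hs (k + 1 + 1)).X_mul_mem_orthogonal hα hβ hγ ha (by omega) (by omega)
        all_goals exact (hs _).mem_orthogonal hα hβ hγ ha (by omega) (by omega)
      rw [mem_orthogonal] at hmem
      have : R2 - C (R2.coeff k) * seq α β γ a k = 0 := by
        refine eq_zero_of_orthogonal (n := n) (m := m) hα hβ hγ ha ?_ hmem.1 hmem.2
        rwa [show n + m = k by omega]
      refine ⟨(X * seq α β γ a (k + 1 + 1) - seq α β γ a (k + 1 + 1 + 1)).coeff (k + 1 + 1),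
        R1.coeff (k + 1), R2.coeff k, ?_⟩
      rw [if_pos (by omega), if_pos (by omega)]
      rw [show k + 1 + 1 - 1 = k + 1 by omega, show k + 1 + 1 - 2 = k by omega]
      linear_combination this + hR2 + hR1
  choose b c d h using key
  exact ⟨b, c, d, h⟩

/-- The coefficient of `x^(k+j-3)` in the `k`-th polynomial of the step line. -/
def lead (α β γ a : ℝ) (j k : ℕ) : ℝ := (X ^ 3 * seq α β γ a k).coeff (k + j)

theorem lead_three {α β γ a : ℝ} (hα : -1 < α) (hβ : -1 < β) (hγ : -1 < γ)
    (ha : a < 0) (k : ℕ) : lead α β γ a 3 k = 1 := by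
  have h1 := monic_seq hα hβ hγ ha k
  have h2 := natDegree_seq hα hβ hγ ha k
  rw [lead, coeff_X_pow_mul, ← h1.coeff_natDegree, h2]

theorem coeff_seq_eq_zero {α β γ a : ℝ} (hα : -1 < α) (hβ : -1 < β) (hγ : -1 < γ)
    (ha : a < 0) {k i : ℕ} (hi : k + 3 < i) : (X ^ 3 * seq α β γ a k).coeff i = 0 := by
  have h2 := natDegree_seq hα hβ hγ ha k
  obtain ⟨i, rfl⟩ : ∃ l, i = l + 3 := ⟨i - 3, by omega⟩
  rw [coeff_X_pow_mul]
  exact coeff_eq_zero_of_natDegree_lt (by omega)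

/-- Compare the coefficients of `x^k` in the recurrence; the two lower polynomials do not reach this
power. The next two powers give `c` and `d` in the same way. -/
theorem IsRecurrence.b_eq {α β γ a : ℝ} (hα : -1 < α) (hβ : -1 < β) (hγ : -1 < γ)
    (ha : a < 0) {b c d : ℕ → ℝ} (h : IsRecurrence α β γ a b c d) (k : ℕ) :
    b k = lead α β γ a 2 k - lead α β γ a 2 (k + 1) := by
  have e := congrArg (fun p => (X ^ 3 * p).coeff (k + 2 + 1)) (h k)
  have l3 := lead_three hα hβ hγ ha k
  rw [mul_left_comm, coeff_X_mul] at e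
  simp only [mul_add, coeff_add, mul_left_comm _ (C _), coeff_C_mul] at e
  have z1 : (X ^ 3 * (if 1 ≤ k then C (c k) * seq α β γ a (k - 1) else 0)).coeff (k + 2 +
      1) = 0 := by
    split_ifs
    · rw [mul_left_comm, coeff_C_mul, coeff_seq_eq_zero hα hβ hγ ha (by omega), mul_zero]
    · simp
  have z2 : (X ^ 3 * (if 2 ≤ k then C (d k) * seq α β γ a (k - 2) else 0)).coeff (k + 2 +
      1) = 0 := by
    split_ifs
    · rw [mul_left_comm, coeff_C_mul, coeff_seq_eq_zero hα hβ hγ ha (by omega), mul_zero]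
    · simp
  rw [z1, z2] at e
  simp only [lead] at *
  rw [show k + 2 + 1 = k + 3 by ring, l3] at e
  rw [show k + 1 + 2 = k + 3 by ring]
  linear_combination -e

theorem IsRecurrence.c_eq {α β γ a : ℝ} (hα : -1 < α) (hβ : -1 < β) (hγ : -1 < γ)
    (ha : a < 0) {b c d : ℕ → ℝ} (h : IsRecurrence α β γ a b c d) (k : ℕ) :
    c (k + 1) = lead α β γ a 1 (k + 1) - lead α β γ a 1 (k + 2)
      - b (k + 1) * lead α β γ a 2 (k + 1) := by
  have e := congrArg (fun p => (X ^ 3 * p).coeff (k + 2 + 1)) (h (k + 1))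
  have l3 := lead_three hα hβ hγ ha k
  rw [mul_left_comm, coeff_X_mul] at e
  rw [if_pos (by omega)] at e
  simp only [mul_add, coeff_add, mul_left_comm _ (C _), coeff_C_mul] at e
  have z2 : (X ^ 3 * (if 2 ≤ k + 1 then C (d (k + 1)) * seq α β γ a (k + 1 - 2) else 0)).coeff
      (k + 2 + 1) = 0 := by
    split_ifs
    · rw [mul_left_comm, coeff_C_mul, coeff_seq_eq_zero hα hβ hγ ha (by omega), mul_zero]
    · simp
  rw [z2] at e
  simp only [lead, add_tsub_cancel_right] at *
  rw [show k + 2 + 1 = k + 3 by ring, l3, show k + 1 + 1 = k + 2 by ring] at e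
  rw [show k + 1 + 1 = k + 2 by ring, show k + 2 + 1 = k + 3 by ring,
    show k + 1 + 2 = k + 3 by ring]
  linear_combination -e

theorem IsRecurrence.d_eq {α β γ a : ℝ} (hα : -1 < α) (hβ : -1 < β) (hγ : -1 < γ)
    (ha : a < 0) {b c d : ℕ → ℝ} (h : IsRecurrence α β γ a b c d) (k : ℕ) :
    d (k + 2) = lead α β γ a 0 (k + 2) - lead α β γ a 0 (k + 3)
      - b (k + 2) * lead α β γ a 1 (k + 2) - c (k + 2) * lead α β γ a 2 (k + 1) := by
  have e := congrArg (fun p => (X ^ 3 * p).coeff (k + 2 + 1)) (h (k + 2))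
  have l3 := lead_three hα hβ hγ ha k
  rw [mul_left_comm, coeff_X_mul] at e
  rw [if_pos (by omega), if_pos (by omega)] at e
  simp only [mul_add, coeff_add, mul_left_comm _ (C _), coeff_C_mul] at e
  simp only [lead, add_tsub_cancel_right, add_zero] at *
  rw [show k + 2 + 1 = k + 3 by ring, show k + 2 - 1 = k + 1 by omega, l3] at e
  rw [show k + 2 + 1 = k + 3 by ring, show k + 1 + 2 = k + 3 by ring]
  linear_combination -e

theorem lead_two_mul (α β γ a : ℝ) (j n : ℕ) :
    lead α β γ a j (2 * n) = (X ^ 3 * poly α β γ a n n).coeff (2 * n + j) := by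
  rw [lead, seq, show (2 * n + 1) / 2 = n by omega, show 2 * n / 2 = n by omega]

/-- Coefficients of the odd members of the step line through those of the even ones. -/
theorem lead_two_mul_add_one {α β γ a : ℝ} (hα : -1 < α) (hβ : -1 < β) (hγ : -1 < γ)
    (ha : a < 0) (j n : ℕ) (hs : α + β + γ + 3 * n + 1 ≠ 0) :
    lead α β γ a j (2 * n + 1) = lead α (β + 1) γ a j (2 * n)
      - ratioX α β γ a n * ((α + β + γ + 2 * n + 1) / (α + β + γ + 3 * n + 1)) *
        lead α β γ a (j + 1) (2 * n) := by
  have h := congrArg (fun p => (X ^ 3 * p).coeff (2 * n + j + 1))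
    (C_mul_poly_succ_self hα hβ hγ ha n)
  simp only [mul_left_comm _ (C _), mul_sub, coeff_sub, coeff_C_mul,
    mul_left_comm (X ^ 3 : ℝ[X]) X, coeff_X_mul] at h
  rw [lead_two_mul, lead_two_mul, lead, seq, show (2 * n + 1 + 1) / 2 = n + 1 by omega,
    show (2 * n + 1) / 2 = n by omega, show 2 * n + 1 + j = 2 * n + j + 1 by ring,
    show 2 * n + (j + 1) = 2 * n + j + 1 by ring]
  generalize α + β + γ + 3 * (n : ℝ) + 1 = D at h hs ⊢
  field_simp
  linear_combination h

theorem poly_succ_self {α β γ a : ℝ} (hα : -1 < α) (hβ : -1 < β) (hγ : -1 < γ)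
    (ha : a < 0) (n : ℕ) (hs : α + β + γ + 3 * n + 1 ≠ 0) :
    poly α β γ a (n + 1) n = X * poly α (β + 1) γ a n n
      - C (ratioX α β γ a n * ((α + β + γ + 2 * n + 1) / (α + β + γ + 3 * n + 1)))
        * poly α β γ a n n := by
  refine mul_left_cancel₀ (C_ne_zero.2 hs) ?_
  rw [C_mul_poly_succ_self hα hβ hγ ha n, mul_sub, ← mul_assoc (C _) (C _), ← C_mul]
  congr 3
  rw [mul_left_comm, mul_div_cancel₀ _ hs, mul_comm]

theorem lead_even {α β γ a : ℝ} (hα : -1 < α) (hβ : -1 < β) (hγ : -1 < γ)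
    (ha : a < 0) (n : ℕ) {A C N : ℝ} (hA : A = α + n) (hC : C = γ + n)
    (hN : N = α + β + γ + 3 * n) :
    (N ≠ 0 → lead α β γ a 2 (2 * n) = numer₁ A C N n a / N) ∧
    (N * (N - 1) ≠ 0 → lead α β γ a 1 (2 * n) = numer₂ A C N n a / (N * (N - 1))) ∧
    (N * (N - 1) * (N - 2) ≠ 0 →
      lead α β γ a 0 (2 * n) = numer₃ A C N n a / (N * (N - 1) * (N - 2))) := by
  obtain ⟨h1, h2, h3⟩ := coeff_poly_self hα hβ hγ ha n hA hC hN
  simp only [lead_two_mul]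
  refine ⟨fun h => ?_, fun h => ?_, fun h => ?_⟩
  · rw [eq_div_iff h, mul_comm]; exact h1
  · rw [eq_div_iff h, mul_comm]; exact h2
  · rw [eq_div_iff h, mul_comm]; exact h3

/-- The coefficients of `P_{1,1}`. -/
theorem lead_two_eq {α β γ a : ℝ} (hα : -1 < α) (hβ : -1 < β) (hγ : -1 < γ) (ha : a < 0) :
    lead α β γ a 2 2 = -(α + 1 + (β + 1) * (1 + a) + (γ + 1) * a) / (α + β + γ + 3) ∧
    lead α β γ a 1 2 = a * (β + 1) / (α + β + γ + 3) ∧ lead α β γ a 0 2 = 0 := by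
  have hc : α + β + γ + 3 ≠ 0 := by
    have : 0 < α + β + γ + 3 := by linarith
    exact this.ne'
  have e0 := C_mul_poly_succ_succ hα hβ hγ ha 0 0
  rw [poly_zero_zero (by linarith) (by linarith) (by linarith) ha] at e0
  simp only [Nat.cast_zero, add_zero, zero_add] at e0
  have e : ∀ k, (α + β + γ + 3) * (X ^ 3 * poly α β γ a 1 1).coeff k =
      (X ^ 3 * raise α β γ a 1).coeff k := by
    intro k
    rw [← e0, mul_left_comm, coeff_C_mul]
  have h2 := (e (2 + 2)).trans (coeff_X_pow_three_mul_raise _ _ _ _ _ _)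
  have h1 := (e (1 + 2)).trans (coeff_X_pow_three_mul_raise _ _ _ _ _ _)
  have h0 := (e (0 + 2)).trans (coeff_X_pow_three_mul_raise _ _ _ _ _ _)
  simp only [mul_one, coeff_X_pow] at h2 h1 h0
  norm_num at h2 h1 h0
  have l := fun j => lead_two_mul α β γ a j 1
  norm_num at l
  rw [l, l, l]
  refine ⟨?_, ?_, ?_⟩
  · rw [eq_div_iff hc]
    linear_combination h2
  · rw [eq_div_iff hc]
    linear_combination h1
  · exact h0.resolve_left hc

theorem lead_zero_eq {α β γ a : ℝ} (hα : -1 < α) (hβ : -1 < β) (hγ : -1 < γ) (ha : a < 0) :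
    lead α β γ a 2 0 = 0 := by
  have := lead_two_mul α β γ a 2 0
  rw [mul_zero, poly_zero_zero hα hβ hγ ha] at this
  rw [this]
  simp [coeff_X_pow]

theorem lead_one_eq {α β γ a : ℝ} (hα : -1 < α) (hβ : -1 < β) (hγ : -1 < γ) (ha : a < 0) :
    lead α β γ a 2 1 = -ratioX α β γ a 0 ∧ lead α β γ a 1 1 = 0 := by
  have h := poly_one_zero hα hβ hγ ha 0
  simp only [Nat.cast_zero, add_zero] at h
  have e : seq α β γ a 1 = X - C (ratioX α β γ a 0) := h
  simp only [lead, e, mul_sub, coeff_sub, coeff_mul_C, coeff_X_pow, ← pow_succ]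
  norm_num

end

/-! ### Rational identities behind the closed formulas. -/

/-- The factor `E_n` in the variables `A = α + n`, `C = γ + n`, `N = α + β + γ + 3n`. -/
def quadE (A C N a : ℝ) : ℝ := C * (N - C) - 2 * a * A * C + a ^ 2 * A * (N - A)

/-- Replacing `β` by `β + 1` keeps `A`, `C`, `n` and turns `N` into `N + 1`; this is the part of
`b_{2n}` free of `X_n`. -/
theorem numer_b_even {A C N n a : ℝ} (h0 : N ≠ 0) (h1 : N + 1 ≠ 0) :
    numer₁ A C N n a / N - numer₁ A C (N + 1) n a / (N + 1) = n * (C + a * A) / (N * (N + 1)) := by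
  simp only [numer₁, expand₁]
  field_simp
  ring

theorem numer_c_even {A C N n a : ℝ} (h : N - 1 ≠ 0) (h0 : N ≠ 0) (h1 : N + 1 ≠ 0) :
    numer₂ A C N n a / (N * (N - 1)) - numer₂ A C (N + 1) n a / ((N + 1) * (N + 1 - 1))
      - n * (C + a * A) / (N * (N + 1)) * (numer₁ A C N n a / N) =
    n * (N - n) / ((N - 1) * N ^ 2 * (N + 1)) * quadE A C N a := by
  rw [add_sub_cancel_right]
  simp only [numer₁, numer₂, expand₁, expand₂, quadE]
  field_simp
  ring

/-- The arguments `A - 1`, `C - 1`, `N - 2`, `n - 1` belong to `P_{n-1,n-1}` with `β + 1`, which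
enters through `P_{n,n-1}`. -/
theorem numer_d_even {A C N n a : ℝ} (h2 : N - 2 ≠ 0) (h : N - 1 ≠ 0) (h0 : N ≠ 0) (h1 : N +
    1 ≠ 0) :
    numer₃ A C N n a / (N * (N - 1) * (N - 2))
      - numer₃ A C (N + 1) n a / ((N + 1) * (N + 1 - 1) * (N + 1 - 2))
      - n * (C + a * A) / (N * (N + 1)) * (numer₂ A C N n a / (N * (N - 1)))
      - n * (N - n) / ((N - 1) * N ^ 2 * (N + 1)) * quadE A C N a *
        (numer₁ (A - 1) (C - 1) (N - 2) (n - 1) a / (N - 2)) =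
    -(a * n * (N - A - C) * (N - n) * (N - n - 1) * (C + a * A)) /
      ((N - 2) * (N - 1) * N ^ 2 * (N + 1)) := by
  rw [add_sub_cancel_right, show N + 1 - 2 = N - 1 by ring]
  simp only [numer₁, numer₂, numer₃, expand₁, expand₂, expand₃, quadE]
  field_simp
  ring

theorem numer_b_odd {α β γ s A C N n a : ℝ} (hα : α = A - n) (hβ : β = N - A - C - n)
    (hγ : γ = C - n) (hs : s = N - 3 * n) (h1 : N + 1 ≠ 0) (h3 : N + 3 ≠ 0) :
    numer₁ A C (N + 1) n a / (N + 1) - numer₁ (A + 1) (C + 1) (N + 3) (n + 1) a / (N + 3) =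
      (5 * n ^ 2 + (4 * α + 4 * β + 3 * γ + 7) * n + (s + 1) * (α + β + 2)
        + a * (5 * n ^ 2 + (3 * α + 4 * β + 4 * γ + 7) * n + (s + 1) * (β + γ + 2)))
        / ((N + 1) * (N + 3)) := by
  subst hα hβ hγ hs
  simp only [numer₁, expand₁]
  field_simp
  ring

/-- The numerator `T_n - a U_n + a² V_n` of `c_{2n+1}`. -/
def numerTUV (α β γ a n : ℝ) : ℝ :=
  n * (n + γ) * (α + β + 2 * n + 1) * (α + β + γ + 3 * n + 3)
    - a * (24 * n ^ 4 + (29 * α + 41 * β + 29 * γ + 48) * n ^ 3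
      + (10 * α ^ 2 + 39 * α * β + 26 * α * γ + 29 * β ^ 2 + 39 * β * γ + 10 * γ ^ 2
        + 44 * α + 62 * β + 44 * γ + 30) * n ^ 2
      + (α ^ 3 + 11 * α ^ 2 * β + 5 * α ^ 2 * γ + 19 * α * β ^ 2 + 24 * α * β * γ
        + 5 * α * γ ^ 2 + 9 * β ^ 3 + 19 * β ^ 2 * γ + 11 * β * γ ^ 2 + γ ^ 3
        + 11 * α ^ 2 + 39 * α * β + 28 * α * γ + 28 * β ^ 2 + 39 * β * γ + 11 * γ ^ 2
        + 19 * α + 25 * β + 19 * γ + 6) * n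
      + (α + β + γ) * (α + β + γ + 1) * (α + β + γ + 2) * (β + 1))
    + a ^ 2 * n * (n + α) * (β + γ + 2 * n + 1) * (α + β + γ + 3 * n + 3)

/-- The numerator `Y_n + a Z_n` of `c_{2n+1}`. -/
def numerYZ (α β γ a n : ℝ) : ℝ :=
  12 * n ^ 3 + (16 * α + 16 * β + 10 * γ + 18) * n ^ 2
    + ((α + β + γ) * (7 * α + 7 * β + 2 * γ) + 16 * α + 16 * β + 10 * γ + 6) * n
    + (α + β + γ) ^ 2 * (α + β) + (α + β + γ) * (3 * α + 3 * β + 2 * γ + 2)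
    + a * (12 * n ^ 3 + (10 * α + 16 * β + 16 * γ + 18) * n ^ 2
      + ((α + β + γ) * (2 * α + 7 * β + 7 * γ) + 10 * α + 16 * β + 16 * γ + 6) * n
      + (α + β + γ) ^ 2 * (β + γ) + (α + β + γ) * (2 * α + 3 * β + 3 * γ + 2))

theorem numer_c_odd {α β γ A C N n a : ℝ} (hα : α = A - n) (hβ : β = N - A - C - n)
    (hγ : γ = C - n) (h0 : N ≠ 0) (h1 : N + 1 ≠ 0) (h2 : N + 2 ≠ 0) (h3 : N + 3 ≠ 0) :
    numer₂ A C (N + 1) n a / ((N + 1) * (N + 1 - 1))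
      - numer₂ (A + 1) (C + 1) (N + 3) (n + 1) a / ((N + 3) * (N + 3 - 1))
      - (numer₁ A C (N + 1) n a / (N + 1) - numer₁ (A + 1) (C + 1) (N + 3) (n + 1) a / (N + 3)) *
        (numer₁ A C (N + 1) n a / (N + 1)) =
      (N - n + 1) / ((N + 3) * (N + 2) * (N + 1) ^ 2 * N) * numerTUV α β γ a n := by
  subst hα hβ hγ
  rw [add_sub_cancel_right, show N + 3 - 1 = N + 2 by ring]
  simp only [numer₁, numer₂, expand₁, expand₂, numerTUV]
  field_simp
  ring

/-- The coefficient in `c_{2n+1}` of `X_n` times `(N - n + 1) / (N + 1)`. -/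
theorem numer_c_odd_linear {α β γ A C N n a : ℝ} (hα : α = A - n) (hβ : β = N - A - C - n)
    (hγ : γ = C - n) (h0 : N ≠ 0) (h1 : N + 1 ≠ 0) (h3 : N + 3 ≠ 0) :
    numer₁ A C (N + 1) n a / (N + 1) - numer₁ (A + 1) (C + 1) (N + 3) (n + 1) a / (N + 3)
      + numer₁ A C (N + 1) n a / (N + 1) - numer₁ A C N n a / N =
      numerYZ α β γ a n / ((N + 3) * (N + 1) * N) := by
  subst hα hβ hγ
  simp only [numer₁, expand₁, numerYZ]
  field_simp
  ring

/-- The numerator `F_n` of `d_{2n+1}`. -/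
def cubicF (α β γ a n : ℝ) : ℝ :=
  (n + γ) * (α + β + 2 * n) * (α + β + 2 * n + 1)
    - a * (n + α) * (n + γ) * (2 * α + 2 * β - γ + 3 * n + 1)
    - a ^ 2 * (n + α) * (n + γ) * (-α + 2 * β + 2 * γ + 3 * n + 1)
    + a ^ 3 * (n + α) * (β + γ + 2 * n) * (β + γ + 2 * n + 1)

theorem numer_d_odd {α β γ A C N n a : ℝ} (hα : α = A - n) (hβ : β = N - A - C - n)
    (hγ : γ = C - n) (h : N - 1 ≠ 0) (h0 : N ≠ 0) (h1 : N + 1 ≠ 0) (h2 : N + 2 ≠ 0)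
    (h3 : N + 3 ≠ 0) :
    numer₃ A C (N + 1) n a / ((N + 1) * (N + 1 - 1) * (N + 1 - 2))
      - numer₃ (A + 1) (C + 1) (N + 3) (n + 1) a / ((N + 3) * (N + 3 - 1) * (N + 3 - 2))
      - (numer₁ A C (N + 1) n a / (N + 1) - numer₁ (A + 1) (C + 1) (N + 3) (n + 1) a / (N + 3)) *
        (numer₂ A C (N + 1) n a / ((N + 1) * (N + 1 - 1)))
      - (N - n + 1) / ((N + 3) * (N + 2) * (N + 1) ^ 2 * N) * numerTUV α β γ a n *
        (numer₁ A C N n a / N) =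
      n * (N - n + 1) * (N - n) / ((N + 2) * (N + 1) ^ 2 * N ^ 2 * (N - 1)) * cubicF α β γ a n := by
  subst hα hβ hγ
  rw [add_sub_cancel_right, show N + 3 - 1 = N + 2 by ring, show N + 3 - 2 = N + 1 by ring,
    show N + 1 - 2 = N - 1 by ring]
  simp only [numer₁, numer₂, numer₃, expand₁, expand₂, expand₃, numerTUV, cubicF]
  field_simp
  ring

/-! ### Closed formulas for the recurrence coefficients. -/

theorem lead_even_shift {α β γ a : ℝ} (hα : -1 < α) (hβ : -1 < β) (hγ : -1 < γ)
    (ha : a < 0) (n : ℕ) {A C N : ℝ} (hA : A = α + n) (hC : C = γ + n)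
    (hN : N = α + β + γ + 3 * n) :
    (N + 1 ≠ 0 → lead α (β + 1) γ a 2 (2 * n) = numer₁ A C (N + 1) n a / (N + 1)) ∧
    (N + 1 ≠ 0 → N ≠ 0 → lead α (β + 1) γ a 1 (2 * n) =
      numer₂ A C (N + 1) n a / ((N + 1) * (N + 1 - 1))) ∧
    (N + 1 ≠ 0 → N ≠ 0 → N - 1 ≠ 0 → lead α (β + 1) γ a 0 (2 * n) =
      numer₃ A C (N + 1) n a / ((N + 1) * (N + 1 - 1) * (N + 1 - 2))) := by
  obtain ⟨h1, h2, h3⟩ := lead_even hα (show -1 < β + 1 by linarith) hγ ha n hA hC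
    (show N + 1 = _ by rw [hN]; ring)
  refine ⟨h1, fun k1 k0 => h2 ?_, fun k1 k0 k => h3 ?_⟩
  · rw [add_sub_cancel_right]
    exact mul_ne_zero k1 k0
  · rw [add_sub_cancel_right, show N + 1 - 2 = N - 1 by ring]
    exact mul_ne_zero (mul_ne_zero k1 k0) k

theorem lead_even_succ {α β γ a : ℝ} (hα : -1 < α) (hβ : -1 < β) (hγ : -1 < γ)
    (ha : a < 0) (n : ℕ) {A C N : ℝ} (hA : A = α + n) (hC : C = γ + n)
    (hN : N = α + β + γ + 3 * n) :
    lead α β γ a 2 (2 * n + 1 + 1) = numer₁ (A + 1) (C + 1) (N + 3) (n + 1) a / (N + 3) ∧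
    (N + 2 ≠ 0 → lead α β γ a 1 (2 * n + 1 + 1) =
      numer₂ (A + 1) (C + 1) (N + 3) (n + 1) a / ((N + 3) * (N + 3 - 1))) ∧
    (N + 2 ≠ 0 → N + 1 ≠ 0 → lead α β γ a 0 (2 * n + 1 + 1) =
      numer₃ (A + 1) (C + 1) (N + 3) (n + 1) a / ((N + 3) * (N + 3 - 1) * (N + 3 - 2))) := by
  have hn : (0 : ℝ) ≤ n := n.cast_nonneg
  have k3 : N + 3 ≠ 0 := by
    have : 0 < N + 3 := by linarith
    exact this.ne'
  obtain ⟨h1, h2, h3⟩ := lead_even hα hβ hγ ha (n + 1) (A := A + 1) (C := C + 1) (N := N + 3)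
    (by rw [hA]; push_cast; ring) (by rw [hC]; push_cast; ring) (by rw [hN]; push_cast; ring)
  rw [show 2 * (n + 1) = 2 * n + 1 + 1 by ring] at h1 h2 h3
  push_cast at h1 h2 h3
  refine ⟨h1 k3, fun k2 => h2 ?_, fun k2 k1 => h3 ?_⟩
  · rw [show N + 3 - 1 = N + 2 by ring]
    exact mul_ne_zero k3 k2
  · rw [show N + 3 - 1 = N + 2 by ring, show N + 3 - 2 = N + 1 by ring]
    exact mul_ne_zero (mul_ne_zero k3 k2) k1

theorem lead_odd {α β γ a : ℝ} (hα : -1 < α) (hβ : -1 < β) (hγ : -1 < γ)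
    (ha : a < 0) (j n : ℕ) {N : ℝ} (hN : N = α + β + γ + 3 * n) (h1 : N + 1 ≠ 0) :
    lead α β γ a j (2 * n + 1) = lead α (β + 1) γ a j (2 * n)
      - ratioX α β γ a n * ((N - n + 1) / (N + 1)) * lead α β γ a (j + 1) (2 * n) := by
  rw [lead_two_mul_add_one hα hβ hγ ha j n (by rwa [← hN]), ← hN,
    show α + β + γ + 2 * n + 1 = N - n + 1 by rw [hN]; ring]

section coefficients

variable {α β γ a : ℝ} {b c d : ℕ → ℝ} {A C N : ℝ}

theorem IsRecurrence.b_even (h : IsRecurrence α β γ a b c d) (hα : -1 < α) (hβ : -1 < β)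
    (hγ : -1 < γ) (ha : a < 0) (n : ℕ) (hA : A = α + n) (hC : C = γ + n)
    (hN : N = α + β + γ + 3 * n) (h0 : N ≠ 0) (h1 : N + 1 ≠ 0) :
    b (2 * n) = n * (C + a * A) / (N * (N + 1)) + ratioX α β γ a n * ((N - n + 1) / (N + 1)) := by
  rw [h.b_eq hα hβ hγ ha, lead_odd hα hβ hγ ha 2 n hN h1, lead_three hα hβ hγ ha,
    (lead_even hα hβ hγ ha n hA hC hN).1 h0, (lead_even_shift hα hβ hγ ha n hA hC hN).1 h1]
  linear_combination numer_b_even (A := A) (C := C) (n := n) (a := a) h0 h1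

/-- The contributions of `X_n` from `P_{n+1,n}` and from `b_{2n}` cancel. -/
theorem IsRecurrence.c_even (h : IsRecurrence α β γ a b c d) (hα : -1 < α) (hβ : -1 < β)
    (hγ : -1 < γ) (ha : a < 0) {n : ℕ} (hn : 1 ≤ n) (hA : A = α + n) (hC : C = γ + n)
    (hN : N = α + β + γ + 3 * n) (hm : N - 1 ≠ 0) (h0 : N ≠ 0) (h1 : N + 1 ≠ 0) :
    c (2 * n) = n * (N - n) / ((N - 1) * N ^ 2 * (N + 1)) * quadE A C N a := by
  have hc := h.c_eq hα hβ hγ ha (2 * n - 1)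
  rw [show 2 * n - 1 + 1 = 2 * n by omega, show 2 * n - 1 + 2 = 2 * n + 1 by omega,
    h.b_even hα hβ hγ ha n hA hC hN h0 h1,
    lead_odd hα hβ hγ ha 1 n hN h1, (lead_even hα hβ hγ ha n hA hC hN).1 h0,
    (lead_even hα hβ hγ ha n hA hC hN).2.1 (mul_ne_zero h0 hm),
    (lead_even_shift hα hβ hγ ha n hA hC hN).2.1 h1 h0] at hc
  rw [hc]
  linear_combination numer_c_even (A := A) (C := C) (n := n) (a := a) hm h0 h1

/-- Here `X_n` cancels again, and only the `X_{n-1}` in the second coefficient of `P_{n,n-1}`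
survives, multiplied by `c_{2n}`. -/
theorem IsRecurrence.d_even (h : IsRecurrence α β γ a b c d) (hα : -1 < α) (hβ : -1 < β)
    (hγ : -1 < γ) (ha : a < 0) {n : ℕ} (hn : 1 ≤ n) (hA : A = α + n) (hC : C = γ + n)
    (hN : N = α + β + γ + 3 * n) (h2 : N - 2 ≠ 0) (hm : N - 1 ≠ 0) (h0 : N ≠ 0) (h1 : N + 1 ≠ 0) :
    d (2 * n) = -(a * n * (N - A - C) * (N - n) * (N - n - 1) * (C + a * A)) /
        ((N - 2) * (N - 1) * N ^ 2 * (N + 1)) +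
      n * (N - n) * (N - n - 1) * ratioX α β γ a (n - 1) /
        ((N - 2) * (N - 1) * N ^ 2 * (N + 1)) * quadE A C N a := by
  have hd := h.d_eq hα hβ hγ ha (2 * n - 2)
  obtain ⟨m, rfl⟩ : ∃ m, n = m + 1 := ⟨n - 1, by omega⟩
  have l := lead_odd hα hβ hγ ha 2 m (N := N - 3) (by rw [hN]; push_cast; ring)
    (by rwa [show N - 3 + 1 = N - 2 by ring])
  have ls := (lead_even_shift hα hβ hγ ha m (A := A - 1) (C := C - 1) (N := N - 3)
    (by rw [hA]; push_cast; ring) (by rw [hC]; push_cast; ring)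
    (by rw [hN]; push_cast; ring)).1 (by rwa [show N - 3 + 1 = N - 2 by ring])
  rw [show 2 * (m + 1) - 2 + 1 = 2 * m + 1 by omega,
    show 2 * (m + 1) - 2 + 2 = 2 * (m + 1) by omega,
    show 2 * (m + 1) - 2 + 3 = 2 * (m + 1) + 1 by omega,
    h.b_even hα hβ hγ ha _ hA hC hN h0 h1,
    h.c_even hα hβ hγ ha hn hA hC hN hm h0 h1,
    lead_odd hα hβ hγ ha 0 (m + 1) hN h1,
    (lead_even hα hβ hγ ha (m + 1) hA hC hN).2.1 (mul_ne_zero h0 hm),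
    (lead_even hα hβ hγ ha (m + 1) hA hC hN).2.2 (mul_ne_zero (mul_ne_zero h0 hm) h2),
    (lead_even_shift hα hβ hγ ha (m + 1) hA hC hN).2.2 h1 h0 hm, l, ls,
    lead_three hα hβ hγ ha] at hd
  rw [hd, add_tsub_cancel_right]
  have key := numer_d_even (A := A) (C := C) (n := m + 1) (a := a) h2 hm h0 h1
  simp only [add_sub_cancel_right] at key
  rw [show N - 3 + 1 = N - 2 by ring, show N - 3 - (m : ℝ) + 1 = N - ((m + 1 : ℕ) : ℝ) - 1 by
    push_cast; ring]
  push_cast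
  have e : ((m : ℝ) + 1) * (N - (m + 1)) * (N - (m + 1) - 1) * ratioX α β γ a m /
        ((N - 2) * (N - 1) * N ^ 2 * (N + 1)) = (m + 1) * (N - (m + 1)) /
        ((N - 1) * N ^ 2 * (N + 1)) * (ratioX α β γ a m * ((N - (m + 1) - 1) / (N - 2))) := by
    field_simp
  rw [e]
  linear_combination key

theorem IsRecurrence.b_odd (h : IsRecurrence α β γ a b c d) (hα : -1 < α) (hβ : -1 < β)
    (hγ : -1 < γ) (ha : a < 0) (n : ℕ) (hA : A = α + n) (hC : C = γ + n)
    (hN : N = α + β + γ + 3 * n) (h1 : N + 1 ≠ 0) :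
    b (2 * n + 1) = numer₁ A C (N + 1) n a / (N + 1)
      - numer₁ (A + 1) (C + 1) (N + 3) (n + 1) a / (N + 3)
      - ratioX α β γ a n * ((N - n + 1) / (N + 1)) := by
  rw [h.b_eq hα hβ hγ ha, lead_odd hα hβ hγ ha 2 n hN h1, lead_three hα hβ hγ ha,
    (lead_even_shift hα hβ hγ ha n hA hC hN).1 h1, (lead_even_succ hα hβ hγ ha n hA hC hN).1]
  ring

theorem IsRecurrence.c_odd (h : IsRecurrence α β γ a b c d) (hα : -1 < α) (hβ : -1 < β)
    (hγ : -1 < γ) (ha : a < 0) (n : ℕ)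
    (hN : N = α + β + γ + 3 * n) (h0 : N ≠ 0) (h1 : N + 1 ≠ 0) (h2 : N + 2 ≠ 0)
    (h3 : N + 3 ≠ 0) :
    c (2 * n + 1) = (N - n + 1) / ((N + 3) * (N + 2) * (N + 1) ^ 2 * N) * numerTUV α β γ a n
      + numerYZ α β γ a n / ((N + 3) * (N + 1) * N) *
        (ratioX α β γ a n * ((N - n + 1) / (N + 1)))
      - (ratioX α β γ a n * ((N - n + 1) / (N + 1))) ^ 2 := by
  obtain ⟨A, hA⟩ : ∃ A, A = α + n := ⟨_, rfl⟩
  obtain ⟨C, hC⟩ : ∃ C, C = γ + n := ⟨_, rfl⟩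
  rw [h.c_eq hα hβ hγ ha, h.b_odd hα hβ hγ ha n hA hC hN h1, lead_odd hα hβ hγ ha 2 n hN h1,
    lead_odd hα hβ hγ ha 1 n hN h1, lead_three hα hβ hγ ha,
    (lead_even hα hβ hγ ha n hA hC hN).1 h0,
    (lead_even_shift hα hβ hγ ha n hA hC hN).1 h1,
    (lead_even_shift hα hβ hγ ha n hA hC hN).2.1 h1 h0,
    (lead_even_succ hα hβ hγ ha n hA hC hN).2.1 h2]
  have k0 := numer_c_odd (α := α) (β := β) (γ := γ) (A := A) (C := C) (n := n) (a := a)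
    (by rw [hA]; ring) (by rw [hN, hA, hC]; ring) (by rw [hC]; ring) h0 h1 h2 h3
  have k1 := numer_c_odd_linear (α := α) (β := β) (γ := γ) (A := A) (C := C) (n := n) (a := a)
    (by rw [hA]; ring) (by rw [hN, hA, hC]; ring) (by rw [hC]; ring) h0 h1 h3
  linear_combination k0 + ratioX α β γ a n * ((N - n + 1) / (N + 1)) * k1

/-- The terms quadratic in `X_n` cancel, and the linear ones collapse to `-c_{2n}` times the scaled
`X_n`. -/
theorem IsRecurrence.d_odd (h : IsRecurrence α β γ a b c d) (hα : -1 < α) (hβ : -1 < β)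
    (hγ : -1 < γ) (ha : a < 0) {n : ℕ} (hn : 1 ≤ n) (hA : A = α + n) (hC : C = γ + n)
    (hN : N = α + β + γ + 3 * n) (hm : N - 1 ≠ 0) (h0 : N ≠ 0) (h1 : N + 1 ≠ 0) (h2 : N + 2 ≠ 0)
    (h3 : N + 3 ≠ 0) :
    d (2 * n + 1) = n * (N - n + 1) * (N - n) / ((N + 2) * (N + 1) ^ 2 * N ^ 2 * (N - 1)) *
        cubicF α β γ a n
      - n * (N - n) / ((N - 1) * N ^ 2 * (N + 1)) * quadE A C N a *
        (ratioX α β γ a n * ((N - n + 1) / (N + 1))) := by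
  have hd := h.d_eq hα hβ hγ ha (2 * n - 1)
  rw [show 2 * n - 1 + 1 = 2 * n by omega, show 2 * n - 1 + 2 = 2 * n + 1 by omega,
    show 2 * n - 1 + 3 = 2 * n + 1 + 1 by omega,
    h.c_odd hα hβ hγ ha n hN h0 h1 h2 h3,
    h.b_odd hα hβ hγ ha n hA hC hN h1,
    lead_odd hα hβ hγ ha 1 n hN h1, lead_odd hα hβ hγ ha 0 n hN h1,
    (lead_even hα hβ hγ ha n hA hC hN).1 h0,
    (lead_even hα hβ hγ ha n hA hC hN).2.1 (mul_ne_zero h0 hm),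
    (lead_even_shift hα hβ hγ ha n hA hC hN).2.1 h1 h0,
    (lead_even_shift hα hβ hγ ha n hA hC hN).2.2 h1 h0 hm,
    (lead_even_succ hα hβ hγ ha n hA hC hN).2.2 h2 h1] at hd
  rw [hd]
  have hA' : α = A - n := by rw [hA]; ring
  have hB' : β = N - A - C - n := by rw [hN, hA, hC]; ring
  have hC' : γ = C - n := by rw [hC]; ring
  have k0 := numer_d_odd (a := a) hA' hB' hC' hm h0 h1 h2 h3
  have k1 := numer_c_odd_linear (a := a) hA' hB' hC' h0 h1 h3
  have k2 := numer_c_even (A := A) (C := C) (n := n) (a := a) hm h0 h1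
  have k3 := numer_b_even (A := A) (C := C) (n := n) (a := a) h0 h1
  -- Undoing the closed form of `b_{2n}` inside `c_{2n}` exposes the coefficients that occur in the
  -- linear part.
  rw [← k3] at k2
  linear_combination k0 - ratioX α β γ a n * ((N - n + 1) / (N + 1)) * k2
    + ratioX α β γ a n * ((N - n + 1) / (N + 1)) * (numer₁ A C N n a / N) * k1

end coefficients

/-! ### Limits of the recurrence coefficients. -/

theorem tendsto_of_tendsto_even_odd {X : Type*} {f : ℕ → X} {l : Filter X}
    (h0 : Tendsto (fun n => f (2 * n)) atTop l) (h1 : Tendsto (fun n => f (2 * n + 1)) atTop l) :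
    Tendsto f atTop l := by
  intro s hs
  obtain ⟨N0, hN0⟩ := mem_atTop_sets.1 (h0 hs)
  obtain ⟨N1, hN1⟩ := mem_atTop_sets.1 (h1 hs)
  refine mem_atTop_sets.2 ⟨2 * (N0 + N1), fun k hk => ?_⟩
  rcases Nat.even_or_odd' k with ⟨m, rfl | rfl⟩
  · exact hN0 m (by omega)
  · exact hN1 m (by omega)

section limits

variable {α β γ a : ℝ} {b c d : ℕ → ℝ} {x : ℝ}

/-- Reduction of a limit along `n` to continuity in `t = 1 / n`. -/
theorem tendsto_of_eq_inv {f X : ℕ → ℝ} {G : ℝ × ℝ → ℝ} {x L : ℝ} (hX : Tendsto X atTop (𝓝 x))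
    (hG : ContinuousAt G (0, x)) (hL : G (0, x) = L)
    (hf : ∀ n : ℕ, 2 ≤ n → ∀ t : ℝ, t * n = 1 → f n = G (t, X n)) :
    Tendsto f atTop (𝓝 L) := by
  have ht : Tendsto (fun n : ℕ => (n : ℝ)⁻¹) atTop (𝓝 0) := tendsto_inv_atTop_nhds_zero_nat
  have := hG.tendsto.comp (ht.prodMk_nhds hX)
  rw [hL] at this
  refine this.congr' ?_
  filter_upwards [eventually_ge_atTop 2] with n hn
  have h0 : (n : ℝ) ≠ 0 := by
    have : n ≠ 0 := by omega
    exact_mod_cast this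
  exact (hf n hn _ (inv_mul_cancel₀ h0)).symm

/-- The factors occurring in the coefficients, written as multiples of `n` with `t = 1 / n`. -/
theorem factor_eq_mul {n s t N : ℝ} (hn : 2 ≤ n) (hs : -3 < s) (hN : N = s + 3 * n)
    (ht : t * n = 1) : 3 < N ∧
    N = n * (3 + s * t) ∧ N + 1 = n * (3 + s * t + t) ∧ N + 2 = n * (3 + s * t + 2 * t) ∧
    N + 3 = n * (3 + s * t + 3 * t) ∧ N - 1 = n * (3 + s * t - t) ∧
    N - 2 = n * (3 + s * t - 2 * t) ∧ N - n = n * (2 + s * t) := by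
  refine ⟨by linarith, ?_, ?_, ?_, ?_, ?_, ?_, ?_⟩
  · rw [hN]; linear_combination -s * ht
  · rw [hN]; linear_combination (-s - 1) * ht
  · rw [hN]; linear_combination (-s - 2) * ht
  · rw [hN]; linear_combination (-s - 3) * ht
  · rw [hN]; linear_combination (-s + 1) * ht
  · rw [hN]; linear_combination (-s + 2) * ht
  · rw [hN]; linear_combination -s * ht

theorem IsRecurrence.tendsto_b_even (h : IsRecurrence α β γ a b c d) (hα : -1 < α) (hβ : -1 < β)
    (hγ : -1 < γ) (ha : a < 0) (hx : Tendsto (ratioX α β γ a) atTop (𝓝 x)) :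
    Tendsto (fun n => b (2 * n)) atTop (𝓝 ((a + 1) / 9 + 2 * x / 3)) := by
  obtain ⟨s, hs⟩ : ∃ s, s = α + β + γ := ⟨_, rfl⟩
  -- `G` is the closed formula with every linear factor divided by `n`: `p.1` stands for `1/n` and
  -- `p.2` for `X_n`. At `p.1 = 0` each denominator factor is 3, so `G` is continuous there. The
  -- limits below follow the same pattern.
  refine tendsto_of_eq_inv hx (G := fun p => (1 + γ * p.1 + a * (1 + α * p.1)) / ((3 +
      s * p.1) * (3 + s * p.1 + p.1)) + p.2 * ((2 + s * p.1 + p.1) / (3 + s * p.1 + p.1)))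
    ?_ ?_ ?_
  · fun_prop (disch := norm_num)
  · norm_num
    ring
  · intro n hn t ht
    have hn' : (2 : ℝ) ≤ n := by exact_mod_cast hn
    have hn0 : (n : ℝ) ≠ 0 := by positivity
    obtain ⟨N, hN⟩ : ∃ N, N = s + 3 * n := ⟨_, rfl⟩
    obtain ⟨hN3, e0, e1, e2, e3, em, em2, en⟩ := factor_eq_mul hn' (by linarith) hN ht
    rw [hs] at hN
    have h0 : N ≠ 0 := by linarith
    have h1 : N + 1 ≠ 0 := by linarith
    have h2 : N + 2 ≠ 0 := by linarith
    have h3 : N + 3 ≠ 0 := by linarith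
    have hm : N - 1 ≠ 0 := by linarith
    have hm2 : N - 2 ≠ 0 := by linarith
    rw [h.b_even hα hβ hγ ha n rfl rfl hN h0 h1]
    have k0 := right_ne_zero_of_mul (e0 ▸ h0)
    have k1 := right_ne_zero_of_mul (e1 ▸ h1)
    have k2 := right_ne_zero_of_mul (e2 ▸ h2)
    have k3 := right_ne_zero_of_mul (e3 ▸ h3)
    have km := right_ne_zero_of_mul (em ▸ hm)
    have km2 := right_ne_zero_of_mul (em2 ▸ hm2)
    have en1 : N - n + 1 = n * (2 + s * t + t) := by linear_combination e1
    have en2 : N - n - 1 = n * (2 + s * t - t) := by linear_combination em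
    have eA : α + n = n * (1 + α * t) := by linear_combination -α * ht
    have eC : γ + n = n * (1 + γ * t) := by linear_combination -γ * ht
    rw [en1, e1, e0, eA, eC]
    field_simp

theorem IsRecurrence.tendsto_b_odd (h : IsRecurrence α β γ a b c d) (hα : -1 < α) (hβ : -1 < β)
    (hγ : -1 < γ) (ha : a < 0) (hx : Tendsto (ratioX α β γ a) atTop (𝓝 x)) :
    Tendsto (fun n => b (2 * n + 1)) atTop (𝓝 (5 * (a + 1) / 9 - 2 * x / 3)) := by
  obtain ⟨s, hs⟩ : ∃ s, s = α + β + γ := ⟨_, rfl⟩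
  refine tendsto_of_eq_inv hx (G := fun p => (5 + (4 * α + 4 * β + 3 * γ + 7) * p.1 + (s +
      1) * (α + β + 2) * p.1 ^ 2
      + a * (5 + (3 * α + 4 * β + 4 * γ + 7) * p.1 + (s + 1) * (β + γ + 2) * p.1 ^ 2)) / ((3 +
          s * p.1 + p.1) * (3 + s * p.1 + 3 * p.1)) - p.2 * ((2 + s * p.1 + p.1) / (3 +
          s * p.1 + p.1)))
    ?_ ?_ ?_
  · fun_prop (disch := norm_num)
  · norm_num
    ring
  · intro n hn t ht
    have hn' : (2 : ℝ) ≤ n := by exact_mod_cast hn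
    have hn0 : (n : ℝ) ≠ 0 := by positivity
    obtain ⟨N, hN⟩ : ∃ N, N = s + 3 * n := ⟨_, rfl⟩
    obtain ⟨hN3, e0, e1, e2, e3, em, em2, en⟩ := factor_eq_mul hn' (by linarith) hN ht
    rw [hs] at hN
    have h0 : N ≠ 0 := by linarith
    have h1 : N + 1 ≠ 0 := by linarith
    have h2 : N + 2 ≠ 0 := by linarith
    have h3 : N + 3 ≠ 0 := by linarith
    have hm : N - 1 ≠ 0 := by linarith
    have hm2 : N - 2 ≠ 0 := by linarith
    rw [h.b_odd hα hβ hγ ha n rfl rfl hN h1, numer_b_odd (s := s) (α := α) (β := β) (γ :=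
        γ) (by ring)
      (by rw [hN]; ring) (by ring) (by rw [hs, hN]; ring) h1 h3]
    have k0 := right_ne_zero_of_mul (e0 ▸ h0)
    have k1 := right_ne_zero_of_mul (e1 ▸ h1)
    have k2 := right_ne_zero_of_mul (e2 ▸ h2)
    have k3 := right_ne_zero_of_mul (e3 ▸ h3)
    have km := right_ne_zero_of_mul (em ▸ hm)
    have km2 := right_ne_zero_of_mul (em2 ▸ hm2)
    have en1 : N - n + 1 = n * (2 + s * t + t) := by linear_combination e1
    have en2 : N - n - 1 = n * (2 + s * t - t) := by linear_combination em
    have eA : α + n = n * (1 + α * t) := by linear_combination -α * ht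
    have eC : γ + n = n * (1 + γ * t) := by linear_combination -γ * ht
    have eB : (5 * (n : ℝ) ^ 2 + (4 * α + 4 * β + 3 * γ + 7) * n + (s + 1) * (α + β + 2)
      + a * (5 * (n : ℝ) ^ 2 + (3 * α + 4 * β + 4 * γ + 7) * n + (s + 1) * (β + γ + 2))) =
        n ^ 2 * (5 + (4 * α + 4 * β + 3 * γ + 7) * t + (s + 1) * (α + β + 2) * t ^ 2
      + a * (5 + (3 * α + 4 * β + 4 * γ + 7) * t + (s + 1) * (β + γ + 2) * t ^ 2)) := by
      have : t = (n : ℝ)⁻¹ := eq_inv_of_mul_eq_one_left ht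
      rw [this]
      field_simp
    rw [eB, en1, e3, e1]
    field_simp

theorem IsRecurrence.tendsto_c_even (h : IsRecurrence α β γ a b c d) (hα : -1 < α) (hβ : -1 < β)
    (hγ : -1 < γ) (ha : a < 0) (hx : Tendsto (ratioX α β γ a) atTop (𝓝 x)) :
    Tendsto (fun n => c (2 * n)) atTop (𝓝 (4 / 81 * (a ^ 2 - a + 1))) := by
  obtain ⟨s, hs⟩ : ∃ s, s = α + β + γ := ⟨_, rfl⟩
  refine tendsto_of_eq_inv hx (G := fun p => (2 + s * p.1) / ((3 + s * p.1 - p.1) * (3 +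
      s * p.1) ^ 2 * (3 + s * p.1 + p.1)) * ((1 + γ * p.1) * (2 + (α + β) * p.1) - 2 * a * (1 +
      α * p.1) * (1 + γ * p.1) + a ^ 2 * (1 + α * p.1) * (2 + (β + γ) * p.1)))
    ?_ ?_ ?_
  · fun_prop (disch := norm_num)
  · norm_num
    ring
  · intro n hn t ht
    have hn' : (2 : ℝ) ≤ n := by exact_mod_cast hn
    have hn0 : (n : ℝ) ≠ 0 := by positivity
    obtain ⟨N, hN⟩ : ∃ N, N = s + 3 * n := ⟨_, rfl⟩
    obtain ⟨hN3, e0, e1, e2, e3, em, em2, en⟩ := factor_eq_mul hn' (by linarith) hN ht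
    rw [hs] at hN
    have h0 : N ≠ 0 := by linarith
    have h1 : N + 1 ≠ 0 := by linarith
    have h2 : N + 2 ≠ 0 := by linarith
    have h3 : N + 3 ≠ 0 := by linarith
    have hm : N - 1 ≠ 0 := by linarith
    have hm2 : N - 2 ≠ 0 := by linarith
    rw [h.c_even hα hβ hγ ha (by omega) rfl rfl hN hm h0 h1]
    have k0 := right_ne_zero_of_mul (e0 ▸ h0)
    have k1 := right_ne_zero_of_mul (e1 ▸ h1)
    have k2 := right_ne_zero_of_mul (e2 ▸ h2)
    have k3 := right_ne_zero_of_mul (e3 ▸ h3)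
    have km := right_ne_zero_of_mul (em ▸ hm)
    have km2 := right_ne_zero_of_mul (em2 ▸ hm2)
    have en1 : N - n + 1 = n * (2 + s * t + t) := by linear_combination e1
    have en2 : N - n - 1 = n * (2 + s * t - t) := by linear_combination em
    have eA : α + n = n * (1 + α * t) := by linear_combination -α * ht
    have eC : γ + n = n * (1 + γ * t) := by linear_combination -γ * ht
    have eE : quadE (α + n) (γ + n) N a = n ^ 2 * ((1 + γ * t) * (2 + (α +
        β) * t) - 2 * a * (1 + α * t) * (1 + γ * t) + a ^ 2 * (1 + α * t) * (2 + (β + γ) * t)) := by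
      have : t = (n : ℝ)⁻¹ := eq_inv_of_mul_eq_one_left ht
      rw [this, hN]
      simp only [quadE]
      field_simp
      ring
    rw [eE, en, e1, em, e0]
    field_simp

theorem IsRecurrence.tendsto_c_odd (h : IsRecurrence α β γ a b c d) (hα : -1 < α) (hβ : -1 < β)
    (hγ : -1 < γ) (ha : a < 0) (hx : Tendsto (ratioX α β γ a) atTop (𝓝 x)) :
    Tendsto (fun n => c (2 * n + 1)) atTop (𝓝 (-(4 / 9) * x ^ 2 + 8 / 27 * (a + 1) * x +
        4 / 81 * (a ^ 2 - 4 * a + 1))) := by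
  obtain ⟨s, hs⟩ : ∃ s, s = α + β + γ := ⟨_, rfl⟩
  refine tendsto_of_eq_inv hx (G := fun p => (2 + s * p.1 + p.1) / ((3 + s * p.1 +
      3 * p.1) * (3 + s * p.1 + 2 * p.1) * (3 + s * p.1 + p.1) ^ 2 * (3 + s * p.1)) * ((1 +
      γ * p.1) * (2 + (α + β + 1) * p.1) * (3 + (s + 3) * p.1)
      - a * (24 + (29 * α + 41 * β + 29 * γ + 48) * p.1
      + (10 * α ^ 2 + 39 * α * β + 26 * α * γ + 29 * β ^ 2 + 39 * β * γ + 10 * γ ^ 2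
        + 44 * α + 62 * β + 44 * γ + 30) * p.1 ^ 2
      + (α ^ 3 + 11 * α ^ 2 * β + 5 * α ^ 2 * γ + 19 * α * β ^ 2 + 24 * α * β * γ
        + 5 * α * γ ^ 2 + 9 * β ^ 3 + 19 * β ^ 2 * γ + 11 * β * γ ^ 2 + γ ^ 3
        + 11 * α ^ 2 + 39 * α * β + 28 * α * γ + 28 * β ^ 2 + 39 * β * γ + 11 * γ ^ 2
        + 19 * α + 25 * β + 19 * γ + 6) * p.1 ^ 3
      + s * (s + 1) * (s + 2) * (β + 1) * p.1 ^ 4)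
      + a ^ 2 * (1 + α * p.1) * (2 + (β + γ + 1) * p.1) * (3 + (s + 3) * p.1))
      + (12 + (16 * α + 16 * β + 10 * γ + 18) * p.1
      + (s * (7 * α + 7 * β + 2 * γ) + 16 * α + 16 * β + 10 * γ + 6) * p.1 ^ 2
      + (s ^ 2 * (α + β) + s * (3 * α + 3 * β + 2 * γ + 2)) * p.1 ^ 3
      + a * (12 + (10 * α + 16 * β + 16 * γ + 18) * p.1
        + (s * (2 * α + 7 * β + 7 * γ) + 10 * α + 16 * β + 16 * γ + 6) * p.1 ^ 2
        + (s ^ 2 * (β + γ) + s * (2 * α + 3 * β + 3 * γ + 2)) * p.1 ^ 3)) / ((3 + s * p.1 +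
            3 * p.1) * (3 + s * p.1 + p.1) * (3 + s * p.1)) * (p.2 * ((2 + s * p.1 + p.1) / (3 +
            s * p.1 + p.1)))
      - (p.2 * ((2 + s * p.1 + p.1) / (3 + s * p.1 + p.1))) ^ 2)
    ?_ ?_ ?_
  · fun_prop (disch := norm_num)
  · norm_num
    ring
  · intro n hn t ht
    have hn' : (2 : ℝ) ≤ n := by exact_mod_cast hn
    have hn0 : (n : ℝ) ≠ 0 := by positivity
    obtain ⟨N, hN⟩ : ∃ N, N = s + 3 * n := ⟨_, rfl⟩
    obtain ⟨hN3, e0, e1, e2, e3, em, em2, en⟩ := factor_eq_mul hn' (by linarith) hN ht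
    rw [hs] at hN
    have h0 : N ≠ 0 := by linarith
    have h1 : N + 1 ≠ 0 := by linarith
    have h2 : N + 2 ≠ 0 := by linarith
    have h3 : N + 3 ≠ 0 := by linarith
    have hm : N - 1 ≠ 0 := by linarith
    have hm2 : N - 2 ≠ 0 := by linarith
    rw [h.c_odd hα hβ hγ ha n hN h0 h1 h2 h3]
    have k0 := right_ne_zero_of_mul (e0 ▸ h0)
    have k1 := right_ne_zero_of_mul (e1 ▸ h1)
    have k2 := right_ne_zero_of_mul (e2 ▸ h2)
    have k3 := right_ne_zero_of_mul (e3 ▸ h3)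
    have km := right_ne_zero_of_mul (em ▸ hm)
    have km2 := right_ne_zero_of_mul (em2 ▸ hm2)
    have en1 : N - n + 1 = n * (2 + s * t + t) := by linear_combination e1
    have en2 : N - n - 1 = n * (2 + s * t - t) := by linear_combination em
    have eA : α + n = n * (1 + α * t) := by linear_combination -α * ht
    have eC : γ + n = n * (1 + γ * t) := by linear_combination -γ * ht
    have enumerTUV : numerTUV α β γ a n = n ^ 4 * ((1 + γ * t) * (2 + (α + β + 1) * t) * (3 +
        (s + 3) * t)
      - a * (24 + (29 * α + 41 * β + 29 * γ + 48) * t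
      + (10 * α ^ 2 + 39 * α * β + 26 * α * γ + 29 * β ^ 2 + 39 * β * γ + 10 * γ ^ 2
        + 44 * α + 62 * β + 44 * γ + 30) * t ^ 2
      + (α ^ 3 + 11 * α ^ 2 * β + 5 * α ^ 2 * γ + 19 * α * β ^ 2 + 24 * α * β * γ
        + 5 * α * γ ^ 2 + 9 * β ^ 3 + 19 * β ^ 2 * γ + 11 * β * γ ^ 2 + γ ^ 3
        + 11 * α ^ 2 + 39 * α * β + 28 * α * γ + 28 * β ^ 2 + 39 * β * γ + 11 * γ ^ 2
        + 19 * α + 25 * β + 19 * γ + 6) * t ^ 3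
      + s * (s + 1) * (s + 2) * (β + 1) * t ^ 4)
      + a ^ 2 * (1 + α * t) * (2 + (β + γ + 1) * t) * (3 + (s + 3) * t)) := by
      have : t = (n : ℝ)⁻¹ := eq_inv_of_mul_eq_one_left ht
      rw [this, hs]
      simp only [numerTUV]
      field_simp
      ring
    have enumerYZ : numerYZ α β γ a n = n ^ 3 * (12 + (16 * α + 16 * β + 10 * γ + 18) * t
      + (s * (7 * α + 7 * β + 2 * γ) + 16 * α + 16 * β + 10 * γ + 6) * t ^ 2
      + (s ^ 2 * (α + β) + s * (3 * α + 3 * β + 2 * γ + 2)) * t ^ 3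
      + a * (12 + (10 * α + 16 * β + 16 * γ + 18) * t
        + (s * (2 * α + 7 * β + 7 * γ) + 10 * α + 16 * β + 16 * γ + 6) * t ^ 2
        + (s ^ 2 * (β + γ) + s * (2 * α + 3 * β + 3 * γ + 2)) * t ^ 3)) := by
      have : t = (n : ℝ)⁻¹ := eq_inv_of_mul_eq_one_left ht
      rw [this, hs]
      simp only [numerYZ]
      field_simp
      ring
    rw [enumerTUV, enumerYZ, en1, e1, e2, e3, e0]
    field_simp

theorem IsRecurrence.tendsto_d_even (h : IsRecurrence α β γ a b c d) (hα : -1 < α) (hβ : -1 < β)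
    (hγ : -1 < γ) (ha : a < 0) (hx : Tendsto (ratioX α β γ a) atTop (𝓝 x)) :
    Tendsto (fun n => d (2 * n)) atTop (𝓝 (4 / 243 * (2 * (a ^ 2 - a + 1) * x - a * (a + 1)))) := by
  obtain ⟨s, hs⟩ : ∃ s, s = α + β + γ := ⟨_, rfl⟩
  -- The formula contains `X_{n-1}`, so the second argument follows the shifted sequence.
  refine tendsto_of_eq_inv (hx.comp (tendsto_sub_atTop_nat 1)) (G := fun p => -(a * (1 +
      β * p.1) * (2 + s * p.1) * (2 + s * p.1 - p.1) *
      (1 + γ * p.1 + a * (1 + α * p.1))) / ((3 + s * p.1 - 2 * p.1) * (3 + s * p.1 - p.1) * (3 +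
          s * p.1) ^ 2 * (3 + s * p.1 + p.1))
      + (2 + s * p.1) * (2 + s * p.1 - p.1) * p.2 / ((3 + s * p.1 - 2 * p.1) * (3 +
          s * p.1 - p.1) * (3 + s * p.1) ^ 2 * (3 + s * p.1 + p.1)) * ((1 + γ * p.1) * (2 + (α +
          β) * p.1) - 2 * a * (1 + α * p.1) * (1 + γ * p.1) + a ^ 2 * (1 + α * p.1) * (2 + (β +
          γ) * p.1)))
    ?_ ?_ ?_
  · fun_prop (disch := norm_num)
  · norm_num
    ring
  · intro n hn t ht
    have hn' : (2 : ℝ) ≤ n := by exact_mod_cast hn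
    have hn0 : (n : ℝ) ≠ 0 := by positivity
    obtain ⟨N, hN⟩ : ∃ N, N = s + 3 * n := ⟨_, rfl⟩
    obtain ⟨hN3, e0, e1, e2, e3, em, em2, en⟩ := factor_eq_mul hn' (by linarith) hN ht
    rw [hs] at hN
    have h0 : N ≠ 0 := by linarith
    have h1 : N + 1 ≠ 0 := by linarith
    have h2 : N + 2 ≠ 0 := by linarith
    have h3 : N + 3 ≠ 0 := by linarith
    have hm : N - 1 ≠ 0 := by linarith
    have hm2 : N - 2 ≠ 0 := by linarith
    rw [h.d_even hα hβ hγ ha (by omega) rfl rfl hN hm2 hm h0 h1]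
    have k0 := right_ne_zero_of_mul (e0 ▸ h0)
    have k1 := right_ne_zero_of_mul (e1 ▸ h1)
    have k2 := right_ne_zero_of_mul (e2 ▸ h2)
    have k3 := right_ne_zero_of_mul (e3 ▸ h3)
    have km := right_ne_zero_of_mul (em ▸ hm)
    have km2 := right_ne_zero_of_mul (em2 ▸ hm2)
    have en1 : N - n + 1 = n * (2 + s * t + t) := by linear_combination e1
    have en2 : N - n - 1 = n * (2 + s * t - t) := by linear_combination em
    have eA : α + n = n * (1 + α * t) := by linear_combination -α * ht
    have eC : γ + n = n * (1 + γ * t) := by linear_combination -γ * ht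
    have eE : quadE (α + n) (γ + n) N a = n ^ 2 * ((1 + γ * t) * (2 + (α +
        β) * t) - 2 * a * (1 + α * t) * (1 + γ * t) + a ^ 2 * (1 + α * t) * (2 + (β + γ) * t)) := by
      have : t = (n : ℝ)⁻¹ := eq_inv_of_mul_eq_one_left ht
      rw [this, hN]
      simp only [quadE]
      field_simp
      ring
    have eB : N - (α + n) - (γ + n) = n * (1 + β * t) := by rw [hN]; linear_combination -β * ht
    dsimp only [Function.comp]
    rw [eE, eB, en2, en, e1, em2, em, e0, eA, eC]
    generalize ((1 + γ * t) * (2 + (α + β) * t) - 2 * a * (1 + α * t) * (1 + γ * t) +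
      a ^ 2 * (1 + α * t) * (2 + (β + γ) * t)) = E
    generalize 3 + s * t - 2 * t = N₂ at km2 ⊢
    generalize 3 + s * t - t = N₁ at km ⊢
    generalize 3 + s * t + t = M₁ at k1 ⊢
    generalize 3 + s * t = M₀ at k0 ⊢
    generalize 1 + γ * t = C
    generalize 1 + α * t = A
    generalize 1 + β * t = B
    generalize 2 + s * t - t = L₁
    generalize 2 + s * t = L₀
    field_simp

theorem IsRecurrence.tendsto_d_odd (h : IsRecurrence α β γ a b c d) (hα : -1 < α) (hβ : -1 < β)
    (hγ : -1 < γ) (ha : a < 0) (hx : Tendsto (ratioX α β γ a) atTop (𝓝 x)) :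
    Tendsto (fun n => d (2 * n + 1)) atTop (𝓝 (4 / 729 * (4 * a ^ 3 - 3 * a ^ 2 - 3 * a +
        4) - 8 * x / 243 * (a ^ 2 - a + 1))) := by
  obtain ⟨s, hs⟩ : ∃ s, s = α + β + γ := ⟨_, rfl⟩
  refine tendsto_of_eq_inv hx (G := fun p => (2 + s * p.1 + p.1) * (2 + s * p.1) / ((3 +
      s * p.1 + 2 * p.1) * (3 + s * p.1 + p.1) ^ 2 * (3 + s * p.1) ^ 2 * (3 +
      s * p.1 - p.1)) * ((1 + γ * p.1) * (2 + (α + β) * p.1) * (2 + (α + β + 1) * p.1)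
      - a * (1 + α * p.1) * (1 + γ * p.1) * (3 + (2 * α + 2 * β - γ + 1) * p.1)
      - a ^ 2 * (1 + α * p.1) * (1 + γ * p.1) * (3 + (-α + 2 * β + 2 * γ + 1) * p.1)
      + a ^ 3 * (1 + α * p.1) * (2 + (β + γ) * p.1) * (2 + (β + γ + 1) * p.1))
      - (2 + s * p.1) / ((3 + s * p.1 - p.1) * (3 + s * p.1) ^ 2 * (3 + s * p.1 + p.1)) * ((1 +
          γ * p.1) * (2 + (α + β) * p.1) - 2 * a * (1 + α * p.1) * (1 + γ * p.1) + a ^ 2 * (1 +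
          α * p.1) * (2 + (β + γ) * p.1)) * (p.2 * ((2 + s * p.1 + p.1) / (3 + s * p.1 + p.1))))
    ?_ ?_ ?_
  · fun_prop (disch := norm_num)
  · norm_num
    ring
  · intro n hn t ht
    have hn' : (2 : ℝ) ≤ n := by exact_mod_cast hn
    have hn0 : (n : ℝ) ≠ 0 := by positivity
    obtain ⟨N, hN⟩ : ∃ N, N = s + 3 * n := ⟨_, rfl⟩
    obtain ⟨hN3, e0, e1, e2, e3, em, em2, en⟩ := factor_eq_mul hn' (by linarith) hN ht
    rw [hs] at hN
    have h0 : N ≠ 0 := by linarith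
    have h1 : N + 1 ≠ 0 := by linarith
    have h2 : N + 2 ≠ 0 := by linarith
    have h3 : N + 3 ≠ 0 := by linarith
    have hm : N - 1 ≠ 0 := by linarith
    have hm2 : N - 2 ≠ 0 := by linarith
    rw [h.d_odd hα hβ hγ ha (by omega) rfl rfl hN hm h0 h1 h2 h3]
    have k0 := right_ne_zero_of_mul (e0 ▸ h0)
    have k1 := right_ne_zero_of_mul (e1 ▸ h1)
    have k2 := right_ne_zero_of_mul (e2 ▸ h2)
    have k3 := right_ne_zero_of_mul (e3 ▸ h3)
    have km := right_ne_zero_of_mul (em ▸ hm)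
    have km2 := right_ne_zero_of_mul (em2 ▸ hm2)
    have en1 : N - n + 1 = n * (2 + s * t + t) := by linear_combination e1
    have en2 : N - n - 1 = n * (2 + s * t - t) := by linear_combination em
    have eA : α + n = n * (1 + α * t) := by linear_combination -α * ht
    have eC : γ + n = n * (1 + γ * t) := by linear_combination -γ * ht
    have eE : quadE (α + n) (γ + n) N a = n ^ 2 * ((1 + γ * t) * (2 + (α +
        β) * t) - 2 * a * (1 + α * t) * (1 + γ * t) + a ^ 2 * (1 + α * t) * (2 + (β + γ) * t)) := by
      have : t = (n : ℝ)⁻¹ := eq_inv_of_mul_eq_one_left ht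
      rw [this, hN]
      simp only [quadE]
      field_simp
      ring
    have ecubicF : cubicF α β γ a n = n ^ 3 * ((1 + γ * t) * (2 + (α + β) * t) * (2 + (α + β +
        1) * t)
      - a * (1 + α * t) * (1 + γ * t) * (3 + (2 * α + 2 * β - γ + 1) * t)
      - a ^ 2 * (1 + α * t) * (1 + γ * t) * (3 + (-α + 2 * β + 2 * γ + 1) * t)
      + a ^ 3 * (1 + α * t) * (2 + (β + γ) * t) * (2 + (β + γ + 1) * t)) := by
      have : t = (n : ℝ)⁻¹ := eq_inv_of_mul_eq_one_left ht
      rw [this]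
      simp only [cubicF]
      field_simp
      ring
    rw [eE, ecubicF, en1, en, e1, em, e2, e0]
    field_simp

end limits

/-! ### Small indices, without restriction on `s`. -/

section small

variable {α β γ a s : ℝ} {b c d : ℕ → ℝ}

theorem IsRecurrence.b_zero (h : IsRecurrence α β γ a b c d) (hα : -1 < α) (hβ : -1 < β)
    (hγ : -1 < γ) (ha : a < 0) : b 0 = ratioX α β γ a 0 := by
  rw [h.b_eq hα hβ hγ ha, lead_zero_eq hα hβ hγ ha, zero_add, (lead_one_eq hα hβ hγ ha).1]
  ring

theorem IsRecurrence.b_one (h : IsRecurrence α β γ a b c d) (hα : -1 < α) (hβ : -1 < β)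
    (hγ : -1 < γ) (ha : a < 0) (hs : s = α + β + γ) :
    b 1 = (α + β + 2 + a * (β + γ + 2)) / (s + 3) - ratioX α β γ a 0 := by
  rw [h.b_eq hα hβ hγ ha, (lead_one_eq hα hβ hγ ha).1, one_add_one_eq_two,
    (lead_two_eq hα hβ hγ ha).1, hs]
  ring

theorem IsRecurrence.c_one (h : IsRecurrence α β γ a b c d) (hα : -1 < α) (hβ : -1 < β)
    (hγ : -1 < γ) (ha : a < 0) (hs : s = α + β + γ) :
    c 1 = (-a * (β + 1) + (α + β + 2 + a * (β + γ + 2)) * ratioX α β γ a 0) / (s + 3)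
      - ratioX α β γ a 0 ^ 2 := by
  have hc := h.c_eq hα hβ hγ ha 0
  rw [zero_add, zero_add, h.b_one hα hβ hγ ha hs, (lead_one_eq hα hβ hγ ha).1,
    (lead_one_eq hα hβ hγ ha).2, (lead_two_eq hα hβ hγ ha).2.1, ← hs] at hc
  rw [hc]
  ring

/-- At `n = 1` the general coefficient formulas divide by `s + 2` and `s + 1`, which may vanish. The
explicit `P_{1,1}`, for `β` and for `β + 1`, needs only `s + 3` and `s + 4`, which are positive. -/
theorem lead_three_eq (hα : -1 < α) (hβ : -1 < β) (hγ : -1 < γ) (ha : a < 0)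
    (hs : s = α + β + γ) :
    lead α β γ a 2 3 = -(α + 1 + (β + 2) * (1 + a) + (γ + 1) * a) / (s + 4)
      - ratioX α β γ a 1 * ((s + 3) / (s + 4)) ∧
    lead α β γ a 1 3 = a * (β + 2) / (s + 4) + ratioX α β γ a 1 *
      ((α + 1 + (β + 1) * (1 + a) + (γ + 1) * a) / (s + 4)) ∧
    lead α β γ a 0 3 = -ratioX α β γ a 1 * (a * (β + 1) / (s + 4)) := by
  have h3 : s + 3 ≠ 0 := by
    have : 0 < s + 3 := by linarith
    exact this.ne'
  have h4 : s + 4 ≠ 0 := by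
    have : 0 < s + 4 := by linarith
    exact this.ne'
  have key : ∀ j, lead α β γ a j 3 = lead α (β + 1) γ a j 2
      - ratioX α β γ a 1 * ((s + 3) / (s + 4)) * lead α β γ a (j + 1) 2 := by
    intro j
    have h := lead_odd hα hβ hγ ha j 1 (N := s + 3) (by rw [hs]; norm_num)
      (by rwa [add_assoc, show (3 : ℝ) + 1 = 4 by norm_num])
    rw [Nat.cast_one, sub_add_cancel, add_assoc, show (3 : ℝ) + 1 = 4 by norm_num] at h
    exact h
  obtain ⟨l2, l1, l0⟩ := lead_two_eq hα hβ hγ ha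
  obtain ⟨m2, m1, m0⟩ := lead_two_eq hα (show -1 < β + 1 by linarith) hγ ha
  rw [← hs] at l2 l1
  rw [show α + (β + 1) + γ + 3 = s + 4 by rw [hs]; ring] at m2 m1
  simp only [key, zero_add, one_add_one_eq_two, show (2 : ℕ) + 1 = 3 from rfl,
      lead_three hα hβ hγ ha, l2, l1, m2, m1, m0]
  refine ⟨?_, ?_, ?_⟩ <;> field_simp <;> ring

theorem IsRecurrence.b_two (h : IsRecurrence α β γ a b c d) (hα : -1 < α) (hβ : -1 < β)
    (hγ : -1 < γ) (ha : a < 0) (hs : s = α + β + γ) :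
    b 2 = (γ + 1 + a * (α + 1)) / ((s + 3) * (s + 4))
      + ratioX α β γ a 1 * ((s + 3) / (s + 4)) := by
  have h3 : s + 3 ≠ 0 := by
    have : 0 < s + 3 := by linarith
    exact this.ne'
  have h4 : s + 4 ≠ 0 := by
    have : 0 < s + 4 := by linarith
    exact this.ne'
  rw [h.b_eq hα hβ hγ ha, show (2 : ℕ) + 1 = 3 from rfl, (lead_three_eq hα hβ hγ ha hs).1,
    (lead_two_eq hα hβ hγ ha).1, ← hs]
  field_simp
  rw [hs]
  ring

theorem IsRecurrence.c_two (h : IsRecurrence α β γ a b c d) (hα : -1 < α) (hβ : -1 < β)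
    (hγ : -1 < γ) (ha : a < 0) (hs : s = α + β + γ) :
    c 2 = ((α + β + 2) * (γ + 1) - 2 * a * (α + 1) * (γ + 1) + a ^ 2 * (β + γ + 2) * (α + 1))
        / ((s + 3) ^ 2 * (s + 4)) := by
  have h3 : s + 3 ≠ 0 := by
    have : 0 < s + 3 := by linarith
    exact this.ne'
  have h4 : s + 4 ≠ 0 := by
    have : 0 < s + 4 := by linarith
    exact this.ne'
  have hc := h.c_eq hα hβ hγ ha 1
  rw [show (1 : ℕ) + 1 = 2 from rfl, show (1 : ℕ) + 2 = 3 from rfl, h.b_two hα hβ hγ ha hs,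
    (lead_two_eq hα hβ hγ ha).1, (lead_two_eq hα hβ hγ ha).2.1,
    (lead_three_eq hα hβ hγ ha hs).2.1, ← hs] at hc
  rw [hc]
  field_simp
  rw [hs]
  ring

theorem IsRecurrence.d_two (h : IsRecurrence α β γ a b c d) (hα : -1 < α) (hβ : -1 < β)
    (hγ : -1 < γ) (ha : a < 0) (hs : s = α + β + γ) :
    d 2 = (-a * (1 + β) * (1 + γ + a * (1 + α))
          + ratioX α β γ a 0 * ((1 + γ) * (α + β + 2) - 2 * a * (1 + γ) * (1 + α)
            + a ^ 2 * (1 + α) * (β + γ + 2)))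
        / ((s + 3) ^ 2 * (s + 4)) := by
  have h3 : s + 3 ≠ 0 := by
    have : 0 < s + 3 := by linarith
    exact this.ne'
  have h4 : s + 4 ≠ 0 := by
    have : 0 < s + 4 := by linarith
    exact this.ne'
  have hd := h.d_eq hα hβ hγ ha 0
  simp only [zero_add] at hd
  rw [h.b_two hα hβ hγ ha hs, h.c_two hα hβ hγ ha hs,
    (lead_two_eq hα hβ hγ ha).2.1, (lead_two_eq hα hβ hγ ha).2.2,
    (lead_three_eq hα hβ hγ ha hs).2.2, (lead_one_eq hα hβ hγ ha).1, ← hs] at hd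
  rw [hd]
  field_simp
  ring

theorem IsRecurrence.d_three (h : IsRecurrence α β γ a b c d) (hα : -1 < α) (hβ : -1 < β)
    (hγ : -1 < γ) (ha : a < 0) (hs : s = α + β + γ) :
    d 3 = ((1 + γ) * (α + β + 2) * (α + β + 3)
            - a * (1 + α) * (1 + γ) * (2 * α + 2 * β - γ + 4)
            - a ^ 2 * (1 + α) * (1 + γ) * (-α + 2 * β + 2 * γ + 4)
            + a ^ 3 * (1 + α) * (β + γ + 2) * (β + γ + 3))
          / ((s + 5) * (s + 4) ^ 2 * (s + 3))
        - ratioX α β γ a 1 * ((1 + γ) * (α + β + 2) - 2 * a * (1 + α) * (1 + γ)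
            + a ^ 2 * (1 + α) * (β + γ + 2))
          / ((s + 4) ^ 2 * (s + 3)) := by
  have h3 : s + 3 ≠ 0 := by
    have : 0 < s + 3 := by linarith
    exact this.ne'
  have h4 : s + 4 ≠ 0 := by
    have : 0 < s + 4 := by linarith
    exact this.ne'
  have h5 : s + 5 ≠ 0 := by
    have : 0 < s + 5 := by linarith
    exact this.ne'
  have h6 : s + 6 ≠ 0 := by
    have : 0 < s + 6 := by linarith
    exact this.ne'
  -- For `P_{2,2}` the general formulas are safe: their denominators `s + 6`, `s + 5`, `s + 4` are
  -- positive.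
  obtain ⟨l2, l1, l0⟩ := lead_even hα hβ hγ ha 2 (A := α + 2) (C := γ + 2) (N := s + 6)
    (by norm_num) (by norm_num) (by rw [hs]; norm_num)
  rw [show s + 6 - 1 = s + 5 by ring] at l1 l0
  rw [show s + 6 - 2 = s + 4 by ring] at l0
  replace l2 : lead α β γ a 2 4 = numer₁ (α + 2) (γ + 2) (s + 6) 2 a / (s + 6) := l2 h6
  replace l1 : lead α β γ a 1 4 = numer₂ (α + 2) (γ + 2) (s + 6) 2 a / ((s + 6) * (s + 5)) :=
    l1 (mul_ne_zero h6 h5)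
  replace l0 : lead α β γ a 0 4 =
      numer₃ (α + 2) (γ + 2) (s + 6) 2 a / ((s + 6) * (s + 5) * (s + 4)) :=
    l0 (mul_ne_zero (mul_ne_zero h6 h5) h4)
  obtain ⟨m2, m1, m0⟩ := lead_three_eq hα hβ hγ ha hs
  have hb := h.b_eq hα hβ hγ ha 3
  have hc := h.c_eq hα hβ hγ ha 2
  have hd := h.d_eq hα hβ hγ ha 1
  rw [show (3 : ℕ) + 1 = 4 from rfl] at hb
  rw [show (2 : ℕ) + 1 = 3 from rfl, show (2 : ℕ) + 2 = 4 from rfl, hb] at hc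
  rw [show (1 : ℕ) + 1 = 2 from rfl, show (1 : ℕ) + 2 = 3 from rfl, show (1 : ℕ) + 3 = 4 from rfl,
    hb, hc, l2, l1, l0, m2, m1, m0, (lead_two_eq hα hβ hγ ha).1, ← hs] at hd
  rw [hd]
  obtain rfl : β = s - α - γ := by rw [hs]; ring
  simp only [numer₁, numer₂, numer₃, expand₁, expand₂, expand₃]
  field_simp
  ring

end small

end JacobiAngelesco

end

/-! ### Assembly of the full statement. -/

theorem mainTheorem11 (α β γ a s : ℝ) (hα : -1 < α) (hβ : -1 < β) (hγ : -1 < γ) (ha : a < 0)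
    (hs : s = α + β + γ) (x : ℕ → ℝ) (hx : ∀ n, x n = JacobiAngelesco.ratioX α β γ a n) :
    -- the polynomials are well defined
    (∀ n m : ℕ, ∃! Q : ℝ[X], JacobiAngelesco.IsTypeII α β γ a n m Q) ∧
    -- `P_{1,0}` with shifted parameters
    (∀ n : ℕ, JacobiAngelesco.poly (α + n) (β + n) (γ + n) a 1 0 = X - C (x n)) ∧
    -- `P_{n+1,n}` in terms of `P_{n,n}`
    (∀ n : ℕ, s + 3 * n + 1 ≠ 0 →
      JacobiAngelesco.poly α β γ a (n + 1) n =
        X * JacobiAngelesco.poly α (β + 1) γ a n n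
          - C (x n * ((s + 2 * n + 1) / (s + 3 * n + 1))) * JacobiAngelesco.poly α β γ a n n) ∧
    -- the recurrence exists
    (∃ b c d : ℕ → ℝ, JacobiAngelesco.IsRecurrence α β γ a b c d) ∧
    -- the limit of `X_n`, and the zeros of `g'`
    (∃! x₁ : ℝ, x₁ ∈ Set.Icc a 0 ∧ deriv (JacobiAngelesco.cubic a) x₁ = 0) ∧
    (∃! x₂ : ℝ, x₂ ∈ Set.Icc 0 1 ∧ deriv (JacobiAngelesco.cubic a) x₂ = 0) ∧
    (∀ x₁ ∈ Set.Icc a 0, deriv (JacobiAngelesco.cubic a) x₁ = 0 → Tendsto x atTop (𝓝 x₁)) ∧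
    ∀ b c d : ℕ → ℝ, JacobiAngelesco.IsRecurrence α β γ a b c d →
      -- explicit coefficients, where the denominators do not vanish
      (∀ n : ℕ, (s + 3 * n) * (s + 3 * n + 1) ≠ 0 →
        b (2 * n) = n * (n + γ + a * (n + α)) / ((s + 3 * n) * (s + 3 * n + 1))
          + x n * ((2 * n + s + 1) / (3 * n + s + 1))) ∧
      (∀ n : ℕ, (s + 3 * n + 1) * (s + 3 * n + 3) ≠ 0 →
        b (2 * n + 1) =
          (5 * n ^ 2 + (4 * α + 4 * β + 3 * γ + 7) * n + (s + 1) * (α + β + 2)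
            + a * (5 * n ^ 2 + (3 * α + 4 * β + 4 * γ + 7) * n + (s + 1) * (β + γ + 2)))
            / ((s + 3 * n + 1) * (s + 3 * n + 3))
          - x n * ((2 * n + s + 1) / (3 * n + s + 1))) ∧
      (∀ n : ℕ, 1 ≤ n → (s + 3 * n - 1) * (s + 3 * n) ^ 2 * (s + 3 * n + 1) ≠ 0 →
        c (2 * n) =
          n * (s + 2 * n) / ((s + 3 * n - 1) * (s + 3 * n) ^ 2 * (s + 3 * n + 1))
          * ((α + β + 2 * n) * (γ + n) - 2 * a * (α + n) * (γ + n)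
            + a ^ 2 * (β + γ + 2 * n) * (α + n))) ∧
      (∀ n : ℕ,
        (s + 3 * n + 3) * (s + 3 * n + 2) * (s + 3 * n + 1) ^ 2 * (s + 3 * n) ≠ 0 →
        c (2 * n + 1) =
          (s + 2 * n + 1)
            / ((s + 3 * n + 3) * (s + 3 * n + 2) * (s + 3 * n + 1) ^ 2 * (s + 3 * n))
            * (n * (n + γ) * (α + β + 2 * n + 1) * (s + 3 * n + 3)
              - a * (24 * n ^ 4 + (29 * α + 41 * β + 29 * γ + 48) * n ^ 3
                + (10 * α ^ 2 + 39 * α * β + 26 * α * γ + 29 * β ^ 2 + 39 * β * γ + 10 * γ ^ 2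
                  + 44 * α + 62 * β + 44 * γ + 30) * n ^ 2
                + (α ^ 3 + 11 * α ^ 2 * β + 5 * α ^ 2 * γ + 19 * α * β ^ 2 + 24 * α * β * γ
                  + 5 * α * γ ^ 2 + 9 * β ^ 3 + 19 * β ^ 2 * γ + 11 * β * γ ^ 2 + γ ^ 3
                  + 11 * α ^ 2 + 39 * α * β + 28 * α * γ + 28 * β ^ 2 + 39 * β * γ + 11 * γ ^ 2
                  + 19 * α + 25 * β + 19 * γ + 6) * n
                + s * (s + 1) * (s + 2) * (β + 1))
              + a ^ 2 * n * (n + α) * (β + γ + 2 * n + 1) * (s + 3 * n + 3))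
          + (s + 2 * n + 1) / ((s + 3 * n + 3) * (s + 3 * n + 1) ^ 2 * (s + 3 * n)) * x n
            * (12 * n ^ 3 + (16 * α + 16 * β + 10 * γ + 18) * n ^ 2
              + (s * (7 * α + 7 * β + 2 * γ) + 16 * α + 16 * β + 10 * γ + 6) * n
              + s ^ 2 * (α + β) + s * (3 * α + 3 * β + 2 * γ + 2)
              + a * (12 * n ^ 3 + (10 * α + 16 * β + 16 * γ + 18) * n ^ 2
                + (s * (2 * α + 7 * β + 7 * γ) + 10 * α + 16 * β + 16 * γ + 6) * n
                + s ^ 2 * (β + γ) + s * (2 * α + 3 * β + 3 * γ + 2)))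
          - (s + 2 * n + 1) ^ 2 / (s + 3 * n + 1) ^ 2 * x n ^ 2) ∧
      (∀ n : ℕ, 1 ≤ n →
        (s + 3 * n - 2) * (s + 3 * n - 1) * (s + 3 * n) ^ 2 * (s + 3 * n + 1) ≠ 0 →
        d (2 * n) =
          -a * n * (n + β) * (s + 2 * n) * (s + 2 * n - 1) * (n + γ + a * (n + α))
            / ((s + 3 * n - 2) * (s + 3 * n - 1) * (s + 3 * n) ^ 2 * (s + 3 * n + 1))
          + n * (s + 2 * n) * (s + 2 * n - 1) * x (n - 1)
            / ((s + 3 * n - 2) * (s + 3 * n - 1) * (s + 3 * n) ^ 2 * (s + 3 * n + 1))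
            * ((n + γ) * (α + β + 2 * n) - 2 * a * (n + γ) * (n + α)
              + a ^ 2 * (n + α) * (β + γ + 2 * n))) ∧
      (∀ n : ℕ, 1 ≤ n →
        (s + 3 * n + 2) * (s + 3 * n + 1) ^ 2 * (s + 3 * n) ^ 2 * (s + 3 * n - 1) ≠ 0 →
        d (2 * n + 1) =
          n * (s + 2 * n + 1) * (s + 2 * n)
            / ((s + 3 * n + 2) * (s + 3 * n + 1) ^ 2 * (s + 3 * n) ^ 2 * (s + 3 * n - 1))
            * ((n + γ) * (α + β + 2 * n) * (α + β + 2 * n + 1)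
              - a * (n + α) * (n + γ) * (2 * α + 2 * β - γ + 3 * n + 1)
              - a ^ 2 * (n + α) * (n + γ) * (-α + 2 * β + 2 * γ + 3 * n + 1)
              + a ^ 3 * (n + α) * (β + γ + 2 * n) * (β + γ + 2 * n + 1))
          - n * (s + 2 * n + 1) * (s + 2 * n) * x n
            / ((s + 3 * n + 1) ^ 2 * (s + 3 * n) ^ 2 * (s + 3 * n - 1))
            * ((n + γ) * (α + β + 2 * n) - 2 * a * (n + α) * (n + γ)
              + a ^ 2 * (n + α) * (β + γ + 2 * n))) ∧
      -- the first coefficients after cancellation of common factors, without restriction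
      b 0 = x 0 ∧
      b 1 = (α + β + 2 + a * (β + γ + 2)) / (s + 3) - x 0 ∧
      c 1 = (-a * (β + 1) + (α + β + 2 + a * (β + γ + 2)) * x 0) / (s + 3) - x 0 ^ 2 ∧
      c 2 = ((α + β + 2) * (γ + 1) - 2 * a * (α + 1) * (γ + 1) + a ^ 2 * (β + γ + 2) * (α + 1))
        / ((s + 3) ^ 2 * (s + 4)) ∧
      d 2 = (-a * (1 + β) * (1 + γ + a * (1 + α))
          + x 0 * ((1 + γ) * (α + β + 2) - 2 * a * (1 + γ) * (1 + α)
            + a ^ 2 * (1 + α) * (β + γ + 2)))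
        / ((s + 3) ^ 2 * (s + 4)) ∧
      d 3 = ((1 + γ) * (α + β + 2) * (α + β + 3)
            - a * (1 + α) * (1 + γ) * (2 * α + 2 * β - γ + 4)
            - a ^ 2 * (1 + α) * (1 + γ) * (-α + 2 * β + 2 * γ + 4)
            + a ^ 3 * (1 + α) * (β + γ + 2) * (β + γ + 3))
          / ((s + 5) * (s + 4) ^ 2 * (s + 3))
        - x 1 * ((1 + γ) * (α + β + 2) - 2 * a * (1 + α) * (1 + γ)
            + a ^ 2 * (1 + α) * (β + γ + 2))
          / ((s + 4) ^ 2 * (s + 3)) ∧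
      -- the limits
      ∀ x₁ ∈ Set.Icc a 0, deriv (JacobiAngelesco.cubic a) x₁ = 0 →
      ∀ x₂ ∈ Set.Icc 0 1, deriv (JacobiAngelesco.cubic a) x₂ = 0 →
        x₁ + x₂ = 2 * (a + 1) / 3 ∧
        Tendsto (fun n => b (2 * n)) atTop (𝓝 ((a + 1) / 9 + 2 * x₁ / 3)) ∧
        Tendsto (fun n => b (2 * n + 1)) atTop (𝓝 (5 * (a + 1) / 9 - 2 * x₁ / 3)) ∧
        Tendsto (fun n => b (2 * n + 1)) atTop (𝓝 ((a + 1) / 9 + 2 * x₂ / 3)) ∧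
        Tendsto c atTop (𝓝 (4 / 81 * (a ^ 2 - a + 1))) ∧
        Tendsto (fun n => c (2 * n + 1)) atTop
          (𝓝 (-(4 / 9) * x₁ ^ 2 + 8 / 27 * (a + 1) * x₁ + 4 / 81 * (a ^ 2 - 4 * a + 1))) ∧
        Tendsto (fun n => d (2 * n)) atTop
          (𝓝 (4 / 243 * (2 * (a ^ 2 - a + 1) * x₁ - a * (a + 1)))) ∧
        Tendsto (fun n => d (2 * n)) atTop (𝓝 (-(4 / 27) * JacobiAngelesco.cubic a x₁)) ∧
        Tendsto (fun n => d (2 * n + 1)) atTop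
          (𝓝 (4 / 729 * (4 * a ^ 3 - 3 * a ^ 2 - 3 * a + 4)
            - 8 * x₁ / 243 * (a ^ 2 - a + 1))) ∧
        Tendsto (fun n => d (2 * n + 1)) atTop (𝓝 (-(4 / 27) * JacobiAngelesco.cubic a x₂)) := by
  open JacobiAngelesco in
  obtain rfl : x = ratioX α β γ a := funext hx
  have hcast : ∀ n : ℕ, (0 : ℝ) ≤ n := fun n => n.cast_nonneg
  refine ⟨fun n m => ?_, poly_one_zero hα hβ hγ ha, fun n hn => ?_, exists_recurrence hα hβ hγ ha,
    existsUnique_deriv_cubic_left ha, existsUnique_deriv_cubic_right ha,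
    fun x₁ h₁ h₁' => tendsto_ratioX hα hβ hγ ha h₁ h₁', fun b c d h => ?_⟩
  · exact ⟨_, isTypeII_poly hα hβ hγ ha n m, fun Q hQ => (poly_eq hα hβ hγ ha hQ).symm⟩
  · subst hs
    exact poly_succ_self hα hβ hγ ha n hn
  refine ⟨fun n hd => ?_, fun n hd => ?_, fun n hn hd => ?_, fun n hd => ?_, fun n hn hd => ?_,
    fun n hn hd => ?_, h.b_zero hα hβ hγ ha, h.b_one hα hβ hγ ha hs, h.c_one hα hβ hγ ha hs,
    h.c_two hα hβ hγ ha hs, h.d_two hα hβ hγ ha hs, h.d_three hα hβ hγ ha hs, ?_⟩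
  · simp only [ne_eq, mul_eq_zero, not_or] at hd
    obtain ⟨h0, h1⟩ := hd
    rw [h.b_even hα hβ hγ ha n rfl rfl (by rw [hs]) h0 h1, show 3 * (n : ℝ) + s + 1 = s +
        3 * n + 1 by ring]
    ring
  · simp only [ne_eq, mul_eq_zero, not_or] at hd
    obtain ⟨h1, h3⟩ := hd
    rw [h.b_odd hα hβ hγ ha n rfl rfl (by rw [hs]) h1,
      numer_b_odd (s := s) (α := α) (β := β) (γ := γ) (by ring) (by rw [hs]; ring) (by ring)
        (by ring) h1 h3, show 3 * (n : ℝ) + s + 1 = s + 3 * n + 1 by ring]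
    ring
  · simp only [ne_eq, mul_eq_zero, not_or, pow_eq_zero_iff, OfNat.ofNat_ne_zero,
      not_false_eq_true] at hd
    obtain ⟨⟨hm, h0⟩, h1⟩ := hd
    rw [h.c_even hα hβ hγ ha hn rfl rfl (by rw [hs]) hm h0 h1, quadE,
      show s + 3 * (n : ℝ) - n = s + 2 * n by ring,
      show s + 3 * (n : ℝ) - (γ + n) = α + β + 2 * n by rw [hs]; ring,
      show s + 3 * (n : ℝ) - (α + n) = β + γ + 2 * n by rw [hs]; ring]
    ring
  · simp only [ne_eq, mul_eq_zero, not_or, pow_eq_zero_iff, OfNat.ofNat_ne_zero,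
      not_false_eq_true] at hd
    obtain ⟨⟨⟨h3, h2⟩, h1⟩, h0⟩ := hd
    rw [h.c_odd hα hβ hγ ha n (N := s + 3 * n) (by rw [hs]) h0 h1 h2 h3, numerTUV, numerYZ, ← hs,
      show s + 3 * (n : ℝ) - n = s + 2 * n by ring]
    generalize s + 3 * (n : ℝ) + 1 = M₁ at h1 ⊢
    field_simp
  · simp only [ne_eq, mul_eq_zero, not_or, pow_eq_zero_iff, OfNat.ofNat_ne_zero,
      not_false_eq_true] at hd
    obtain ⟨⟨⟨hm2, hm⟩, h0⟩, h1⟩ := hd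
    rw [h.d_even hα hβ hγ ha hn rfl rfl (by rw [hs]) hm2 hm h0 h1, quadE,
      show s + 3 * (n : ℝ) - n = s + 2 * n by ring,
      show s + 3 * (n : ℝ) - (α + n) - (γ + n) = n + β by rw [hs]; ring,
      show s + 3 * (n : ℝ) - (γ + n) = α + β + 2 * n by rw [hs]; ring,
      show s + 3 * (n : ℝ) - (α + n) = β + γ + 2 * n by rw [hs]; ring]
    ring
  · simp only [ne_eq, mul_eq_zero, not_or, pow_eq_zero_iff, OfNat.ofNat_ne_zero,
      not_false_eq_true] at hd
    obtain ⟨⟨⟨h2, h1⟩, h0⟩, hm⟩ := hd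
    -- This factor is absent from the stated denominator, but it is always positive as `s > -3`.
    have h3 : s + 3 * (n : ℝ) + 3 ≠ 0 := by
      have : 0 < s + 3 * (n : ℝ) + 3 := by linarith [hcast n]
      exact this.ne'
    rw [h.d_odd hα hβ hγ ha hn rfl rfl (by rw [hs]) hm h0 h1 h2 h3, quadE, cubicF,
      show s + 3 * (n : ℝ) - n = s + 2 * n by ring,
      show s + 3 * (n : ℝ) - (γ + n) = α + β + 2 * n by rw [hs]; ring,
      show s + 3 * (n : ℝ) - (α + n) = β + γ + 2 * n by rw [hs]; ring]
    generalize s + 3 * (n : ℝ) + 2 = M₂ at h2 ⊢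
    generalize s + 3 * (n : ℝ) + 1 = M₁ at h1 ⊢
    generalize s + 3 * (n : ℝ) - 1 = N₁ at hm ⊢
    generalize s + 3 * (n : ℝ) = N at h0 ⊢
    field_simp
    ring
  · intro x₁ h₁ h₁' x₂ h₂ h₂'
    have hx := tendsto_ratioX hα hβ hγ ha h₁ h₁'
    rw [deriv_cubic] at h₁' h₂'
    -- The intervals meet only at `0`, where the derivative is `a ≠ 0`; distinctness then allows
    -- Vieta's relation for the sum.
    have hne : x₁ ≠ x₂ := by
      rintro rfl
      obtain rfl : x₁ = 0 := le_antisymm h₁.2 h₂.1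
      norm_num at h₁'
      exact ha.ne h₁'
    have hsum : 3 * (x₁ + x₂) = 2 * (a + 1) := mul_left_cancel₀ (sub_ne_zero.2 hne)
      (by linear_combination h₁' - h₂')
    have hx₂ : x₂ = 2 * (a + 1) / 3 - x₁ := by linear_combination hsum / 3
    have tb := h.tendsto_b_odd hα hβ hγ ha hx
    have tc := h.tendsto_c_even hα hβ hγ ha hx
    have tc' := h.tendsto_c_odd hα hβ hγ ha hx
    have td := h.tendsto_d_even hα hβ hγ ha hx
    have td' := h.tendsto_d_odd hα hβ hγ ha hx
    -- The two expressions differ by a multiple of `g'(x₁)`, so the even and odd limits of `c`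
    -- agree.
    have ec : -(4 / 9) * x₁ ^ 2 + 8 / 27 * (a + 1) * x₁ + 4 / 81 * (a ^ 2 - 4 * a + 1) =
        4 / 81 * (a ^ 2 - a + 1) := by linear_combination (-4 / 27) * h₁'
    refine ⟨by rw [hx₂]; ring, h.tendsto_b_even hα hβ hγ ha hx, tb, ?_,
      tendsto_of_tendsto_even_odd tc (ec ▸ tc'), tc', td, ?_, td', ?_⟩
    · convert tb using 2
      rw [hx₂]
      ring
    · convert td using 2
      rw [cubic]
      -- The linear expression in `x₁` is the remainder of `-(4/27) g` modulo `g'`; the multiplier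
      -- is the quotient up to sign.
      linear_combination (-4 / 81 * x₁ + 4 / 243 * (a + 1)) * h₁'
    · convert td' using 2
      rw [cubic, hx₂]
      linear_combination (4 / 81 * x₁ - 4 / 243 * (a + 1)) * h₁'
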